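/- Let $n\ge 1$ and $m\ge 0$ be integers. The Yoke graph $Y_{n,m}$ is the simple graph whose vertices are the tuples $v=(v_0,v_1,\dots,v_m,v_{m+1})\in\mathbb{Z}_n\times\{0,1\}^m\times\mathbb{Z}_n$ with $\sum_{i=0}^{m+1}v_i\equiv 0\pmod n$; two distinct vertices $u,v$ are adjacent if there is $0\le i\le m$ such that $u_j=v_j$ for all $j\notin\{i,i+1\}$ and either $u_i=v_i+1$, $u_{i+1}=v_{i+1}-1$, or $u_i=v_i-1$, $u_{i+1}=v_{i+1}+1$ (equations for the entries $0$ and $m+1$ are in $\mathbb{Z}_n$, the others in $\mathbb{Z}$). Let $\varphi,\psi,\tau$ be the automorphisms of $Y_{n,m}$ given by $$\varphi(v)=(v_0+1,v_1,\dots,v_m,v_{m+1}-1),\quad \psi(v)=(v_{m+1},v_m,\dots,v_1,v_0),\quad \tau(v)=(-v_0,1-v_1,\dots,1-v_m,-(m+v_{m+1})).$$ Let $C_2$ be the cyclic group of order $2$ and, for $k\ge1$, let $D_k=\langle g,h\mid g^k=h^2=1,\ hgh=g^{-1}\rangle$ be the dihedral group of order $2k$. **Theorem.** 1. $\mathrm{Aut}(Y_{1,3})\cong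 D_4\times C_2$. 2. For all $n\ge 1$ and $m\ge 0$ with $m\ne 2$ and $(n,m)\ne(1,3)$, $\mathrm{Aut}(Y_{n,m})=\langle\varphi,\psi,\tau\rangle$. Moreover, for all such $n,m$: - $\mathrm{Aut}(Y_{1,0})$ is trivial, and $\mathrm{Aut}(Y_{2,0})\cong\mathrm{Aut}(Y_{1,1})\cong C_2$; - $\mathrm{Aut}(Y_{n,0})\cong D_n$ if $n>2$; - $\mathrm{Aut}(Y_{1,m})\cong C_2\times C_2$ if $m>1$; - $\mathrm{Aut}(Y_{n,m})\cong D_{2n}$ if $n>1$, $m>0$ and at least one of $n,m$ is odd; - $\mathrm{Aut}(Y_{n,m})\cong D_n\times C_2$ if $n>1$, $m>0$ and both $n,m$ are even. -/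

import Mathlib

/-- The vertices of the Yoke graph `Y_{n,m}`: the tuples `(v_0, v_1, …, v_m, v_{m+1})` in
`ℤ/n × {0,1}^m × ℤ/n` with `v_0 + v_1 + ⋯ + v_{m+1} ≡ 0 (mod n)`. The entry `v_0` is `left`,
the entry `v_{m+1}` is `right`, and `v_{i+1}` is `mid i` for `i < m`. -/
@[ext]
structure YokeVertex (n m : ℕ) where
  left : ZMod n
  mid : Fin m → Fin 2
  right : ZMod n
  sum_eq_zero : left + (∑ i, ((mid i : ℕ) : ZMod n)) + right = 0

namespace YokeVertex

/-- `u.EntryEq v j d` says that `u_j = v_j + d`. The equation is read in `ℤ/n` for the two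
buckets `j = 0` and `j = m + 1`, and in `ℤ` for `1 ≤ j ≤ m`. (It is only used for
`j ≤ m + 1`.) -/
def EntryEq {n m : ℕ} (u v : YokeVertex n m) (j : ℕ) (d : ℤ) : Prop :=
  if j = 0 then u.left = v.left + (d : ZMod n)
  else if h : j - 1 < m then
    ((u.mid ⟨j - 1, h⟩ : ℕ) : ℤ) = ((v.mid ⟨j - 1, h⟩ : ℕ) : ℤ) + d
  else u.right = v.right + (d : ZMod n)

/-- `u` is obtained from `v` by shifting a unit between the entries `i` and `i + 1`, in one of
the two directions. -/
def Shift {n m : ℕ} (u v : YokeVertex n m) (i : ℕ) : Prop :=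
  (∀ j ≤ m + 1, j ≠ i → j ≠ i + 1 → u.EntryEq v j 0) ∧
    ((u.EntryEq v i 1 ∧ u.EntryEq v (i + 1) (-1)) ∨
      (u.EntryEq v i (-1) ∧ u.EntryEq v (i + 1) 1))

theorem EntryEq.neg {n m : ℕ} {u v : YokeVertex n m} {j : ℕ} {d : ℤ}
    (h : u.EntryEq v j d) : v.EntryEq u j (-d) := by
  unfold EntryEq at *
  split_ifs at * with h1 h2
  · rw [h]; push_cast; ring
  · rw [h]; ring
  · rw [h]; push_cast; ring

theorem Shift.symm {n m : ℕ} {u v : YokeVertex n m} {i : ℕ} (h : u.Shift v i) :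
    v.Shift u i := by
  obtain ⟨h0, h1⟩ := h
  refine ⟨fun j hj a b => by simpa using (h0 j hj a b).neg, ?_⟩
  rcases h1 with ⟨a, b⟩ | ⟨a, b⟩
  · exact Or.inr ⟨a.neg, by simpa using b.neg⟩
  · exact Or.inl ⟨by simpa using a.neg, b.neg⟩

end YokeVertex

/-- The Yoke graph `Y_{n,m}`, as a simple graph. (The condition `u ≠ v` only matters for
`Y_{1,0}`, which is the graph with one vertex and no loop.) -/
def yokeGraph (n m : ℕ) : SimpleGraph (YokeVertex n m) where
  Adj u v := u ≠ v ∧ ∃ i ≤ m, u.Shift v i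
  symm := ⟨fun _ _ h => ⟨h.1.symm, h.2.imp fun _ hi => ⟨hi.1, hi.2.symm⟩⟩⟩
  loopless := ⟨fun _ h => h.1 rfl⟩

/-- The automorphism group of `Y_{n,m}`; multiplication is composition of functions. -/
abbrev YokeAut (n m : ℕ) : Type := yokeGraph n m ≃g yokeGraph n m

namespace YokeVertex

/-- `φ(v_0, v_1, …, v_m, v_{m+1}) = (v_0 + 1, v_1, …, v_m, v_{m+1} - 1)`. -/
def rotate {n m : ℕ} (v : YokeVertex n m) : YokeVertex n m where
  left := v.left + 1
  mid := v.mid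
  right := v.right - 1
  sum_eq_zero := by rw [← v.sum_eq_zero]; ring

/-- The inverse of `rotate`. -/
def unrotate {n m : ℕ} (v : YokeVertex n m) : YokeVertex n m where
  left := v.left - 1
  mid := v.mid
  right := v.right + 1
  sum_eq_zero := by rw [← v.sum_eq_zero]; ring

/-- `ψ(v_0, v_1, …, v_m, v_{m+1}) = (v_{m+1}, v_m, …, v_1, v_0)`. -/
def reverse {n m : ℕ} (v : YokeVertex n m) : YokeVertex n m where
  left := v.right
  mid := fun i => v.mid i.rev
  right := v.left
  sum_eq_zero := by
    have h : ∑ i : Fin m, ((v.mid i.rev : ℕ) : ZMod n) = ∑ i, ((v.mid i : ℕ) : ZMod n) :=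
      Equiv.sum_comp Fin.revPerm fun i => ((v.mid i : ℕ) : ZMod n)
    rw [h, ← v.sum_eq_zero]; ring

theorem coe_one_sub (x : Fin 2) : (((1 - x : Fin 2) : ℕ) : ℤ) = 1 - ((x : ℕ) : ℤ) := by
  fin_cases x <;> rfl

/-- `τ(v_0, v_1, …, v_m, v_{m+1}) = (-v_0, 1 - v_1, …, 1 - v_m, -(m + v_{m+1}))`. -/
def complement {n m : ℕ} (v : YokeVertex n m) : YokeVertex n m where
  left := -v.left
  mid := fun i => 1 - v.mid i
  right := -((m : ZMod n) + v.right)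
  sum_eq_zero := by
    have h : ∀ i, (((1 - v.mid i : Fin 2) : ℕ) : ZMod n) = 1 - ((v.mid i : ℕ) : ZMod n) := by
      intro i
      have := congrArg (Int.cast : ℤ → ZMod n) (coe_one_sub (v.mid i))
      simpa using this
    simp only [h, Finset.sum_sub_distrib]
    rw [← neg_eq_zero.mpr v.sum_eq_zero]
    simp
    ring

theorem rotate_unrotate {n m : ℕ} (v : YokeVertex n m) : v.unrotate.rotate = v := by
  ext <;> simp [rotate, unrotate]

theorem unrotate_rotate {n m : ℕ} (v : YokeVertex n m) : v.rotate.unrotate = v := by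
  ext <;> simp [rotate, unrotate]

theorem reverse_reverse {n m : ℕ} (v : YokeVertex n m) : v.reverse.reverse = v := by
  ext <;> simp [reverse]

theorem complement_complement {n m : ℕ} (v : YokeVertex n m) :
    v.complement.complement = v := by
  ext <;> simp [complement]

theorem EntryEq.rotate {n m : ℕ} {u v : YokeVertex n m} {j : ℕ} {d : ℤ}
    (h : u.EntryEq v j d) : u.rotate.EntryEq v.rotate j d := by
  unfold EntryEq YokeVertex.rotate at *
  split_ifs at * with h1 h2
  · simp only [h]; ring
  · simpa using h
  · simp only [h]; ring

theorem EntryEq.unrotate {n m : ℕ} {u v : YokeVertex n m} {j : ℕ} {d : ℤ}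
    (h : u.EntryEq v j d) : u.unrotate.EntryEq v.unrotate j d := by
  unfold EntryEq YokeVertex.unrotate at *
  split_ifs at * with h1 h2
  · simp only [h]; ring
  · simpa using h
  · simp only [h]; ring

theorem EntryEq.complement {n m : ℕ} {u v : YokeVertex n m} {j : ℕ} {d : ℤ}
    (h : u.EntryEq v j d) : u.complement.EntryEq v.complement j (-d) := by
  unfold EntryEq YokeVertex.complement at *
  split_ifs at * with h1 h2
  · simp only [h]; push_cast; ring
  · simp only [coe_one_sub, h]; ring
  · simp only [h]; push_cast; ring

theorem EntryEq.reverse {n m : ℕ} {u v : YokeVertex n m} {j k : ℕ} {d : ℤ}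
    (hjk : j + k = m + 1) (h : u.EntryEq v j d) : u.reverse.EntryEq v.reverse k d := by
  unfold EntryEq YokeVertex.reverse at *
  by_cases hk : k = 0
  · have h1 : ¬ j = 0 := by omega
    have h2 : ¬ j - 1 < m := by omega
    simpa [hk, h1, h2] using h
  · by_cases hj : j = 0
    · have h2 : ¬ k - 1 < m := by omega
      simpa [hk, hj, h2] using h
    · have h1 : j - 1 < m := by omega
      have h2 : k - 1 < m := by omega
      have h3 : (⟨k - 1, h2⟩ : Fin m).rev = ⟨j - 1, h1⟩ := by
        ext; simp only [Fin.val_rev]; omega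
      simp only [hk, hj, h1, h2, h3, if_false, dif_pos] at h ⊢
      exact h

theorem Shift.rotate {n m : ℕ} {u v : YokeVertex n m} {i : ℕ} (h : u.Shift v i) :
    u.rotate.Shift v.rotate i :=
  ⟨fun j hj a b => (h.1 j hj a b).rotate,
    h.2.imp (fun h => ⟨h.1.rotate, h.2.rotate⟩) fun h => ⟨h.1.rotate, h.2.rotate⟩⟩

theorem Shift.unrotate {n m : ℕ} {u v : YokeVertex n m} {i : ℕ} (h : u.Shift v i) :
    u.unrotate.Shift v.unrotate i :=
  ⟨fun j hj a b => (h.1 j hj a b).unrotate,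
    h.2.imp (fun h => ⟨h.1.unrotate, h.2.unrotate⟩) fun h => ⟨h.1.unrotate, h.2.unrotate⟩⟩

theorem Shift.complement {n m : ℕ} {u v : YokeVertex n m} {i : ℕ} (h : u.Shift v i) :
    u.complement.Shift v.complement i := by
  refine ⟨fun j hj a b => by simpa using (h.1 j hj a b).complement, ?_⟩
  rcases h.2 with ⟨a, b⟩ | ⟨a, b⟩
  · exact Or.inr ⟨a.complement, by simpa using b.complement⟩
  · exact Or.inl ⟨by simpa using a.complement, b.complement⟩

theorem Shift.reverse {n m : ℕ} {u v : YokeVertex n m} {i : ℕ} (hi : i ≤ m)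
    (h : u.Shift v i) : u.reverse.Shift v.reverse (m - i) := by
  refine ⟨fun j hj a b => (h.1 (m + 1 - j) (by omega) (by omega) (by omega)).reverse
    (by omega), ?_⟩
  rcases h.2 with ⟨a, b⟩ | ⟨a, b⟩
  · exact Or.inr ⟨b.reverse (by omega), a.reverse (by omega)⟩
  · exact Or.inl ⟨b.reverse (by omega), a.reverse (by omega)⟩

end YokeVertex

/-- A pair of mutually inverse adjacency-preserving maps is an automorphism. -/
def YokeAut.mk' {n m : ℕ} (f g : YokeVertex n m → YokeVertex n m)
    (hgf : ∀ v, g (f v) = v) (hfg : ∀ v, f (g v) = v)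
    (hf : ∀ u v, ∀ i ≤ m, u.Shift v i → ∃ j ≤ m, (f u).Shift (f v) j)
    (hg : ∀ u v, ∀ i ≤ m, u.Shift v i → ∃ j ≤ m, (g u).Shift (g v) j) : YokeAut n m where
  toFun := f
  invFun := g
  left_inv := hgf
  right_inv := hfg
  map_rel_iff' := by
    intro u v
    have hinj : Function.Injective f := Function.LeftInverse.injective hgf
    constructor
    · rintro ⟨hne, i, hi, h⟩
      refine ⟨fun e => hne (congrArg f e), ?_⟩
      have := hg _ _ i hi h
      change ∃ j ≤ m, (g (f u)).Shift (g (f v)) j at this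
      rwa [hgf, hgf] at this
    · rintro ⟨hne, i, hi, h⟩
      exact ⟨fun e => hne (hinj e), hf _ _ i hi h⟩

/-- The automorphism `φ` (bucket rotation) of `Y_{n,m}`. -/
def yokePhi (n m : ℕ) : YokeAut n m :=
  YokeAut.mk' YokeVertex.rotate YokeVertex.unrotate YokeVertex.unrotate_rotate
    YokeVertex.rotate_unrotate (fun _ _ i hi h => ⟨i, hi, h.rotate⟩)
    (fun _ _ i hi h => ⟨i, hi, h.unrotate⟩)

/-- The automorphism `ψ` (reversal) of `Y_{n,m}`. -/
def yokePsi (n m : ℕ) : YokeAut n m :=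
  YokeAut.mk' YokeVertex.reverse YokeVertex.reverse YokeVertex.reverse_reverse
    YokeVertex.reverse_reverse (fun _ _ i hi h => ⟨m - i, by omega, h.reverse hi⟩)
    (fun _ _ i hi h => ⟨m - i, by omega, h.reverse hi⟩)

/-- The automorphism `τ` (complement) of `Y_{n,m}`. -/
def yokeTau (n m : ℕ) : YokeAut n m :=
  YokeAut.mk' YokeVertex.complement YokeVertex.complement YokeVertex.complement_complement
    YokeVertex.complement_complement (fun _ _ i hi h => ⟨i, hi, h.complement⟩)
    (fun _ _ i hi h => ⟨i, hi, h.complement⟩)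

/-- The subgroup `⟨φ, ψ, τ⟩` of the automorphism group of `Y_{n,m}`. -/
def yokeFundamental (n m : ℕ) : Subgroup (YokeAut n m) :=
  Subgroup.closure {yokePhi n m, yokePsi n m, yokeTau n m}

/-- The cyclic group of order two, written multiplicatively. -/
abbrev CyclicTwo : Type := Multiplicative (ZMod 2)

/-! Replace a tuple by integer lifts of its partial sums `v_0 + … + v_k`, `0 ≤ k ≤ m`. Consecutive
sums differ by 0 or 1, an edge changes a single sum by ±1, and the lifts of a given vertex differ by
a common multiple of `n` (`Displaced`). For `m ≥ 1` the index of the changed sum forces the sign, so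
it labels the edge (`Step`). If `n(m+1) > 4`, closed walks of length four lift to closed walks, so
squares are controlled (`Step.common_neighbor`).

Rigidity: an automorphism fixing a vertex and all its neighbours ("a fixed star") fixes the star of
an adjacent vertex unless new labels interfere, since a square through fixed vertices pins its
fourth corner. Starting from `(0, 0, …, 0)`, one can reach every vertex by steps creating at most
one new label, except for `100… → 010…`, where degrees (`m ≥ 4`) or one more square (`m = 3`) help
(`FixesStar.step_one`). Hence `eq_one_of_fixesStar`. For `m ≥ 2` the degree two vertices are those
with constant middle; `τ` and powers of `φ` carry them to `(0, 0, …, 0)`, and `ψ` exchanges its two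
neighbours. So the three automorphisms generate. For `m = 0` the graph is a cycle, possibly
degenerate.

Group structure: `ρ = τψφ^j` commutes with `φ`, is inverted by `ψ`, and has square `φ^(m+2j)`. If
`n` or `m` is odd, `j` can be chosen with `ρ² = φ`, which gives `D_{2n}`; if `m` is even, `j = -m/2`
makes `ρ` a central involution.

The graph `Y_{1,3}` has eight vertices and extra symmetries exchanging twins; it is treated by
enumeration. -/

namespace YokeVertex

/-! ### Partial sums and their displacements -/

/-- The `k`-th middle entry as an integer, indexed from `0`, and `0` beyond the last one. -/
def bit {n m : ℕ} (v : YokeVertex n m) (k : ℕ) : ℤ :=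
  if h : k < m then ((v.mid ⟨k, h⟩ : ℕ) : ℤ) else 0

theorem bit_of_lt {n m : ℕ} (v : YokeVertex n m) {k : ℕ} (h : k < m) :
    v.bit k = ((v.mid ⟨k, h⟩ : ℕ) : ℤ) := dif_pos h

theorem bit_eq_zero_or_one {n m : ℕ} (v : YokeVertex n m) (k : ℕ) :
    v.bit k = 0 ∨ v.bit k = 1 := by
  unfold bit
  split_ifs with h
  · have := (v.mid ⟨k, h⟩).isLt
    omega
  · simp

theorem ext_bit {n m : ℕ} {u v : YokeVertex n m} (hl : u.left = v.left)
    (hb : ∀ k < m, u.bit k = v.bit k) : u = v := by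
  have hmid : u.mid = v.mid := by
    funext k
    have := hb k k.isLt
    rw [bit_of_lt _ k.isLt, bit_of_lt _ k.isLt] at this
    exact Fin.ext (by exact_mod_cast this)
  refine YokeVertex.ext hl hmid ?_
  have hu := u.sum_eq_zero
  have hv := v.sum_eq_zero
  rw [hl, hmid] at hu
  exact add_left_cancel (hu.trans hv.symm)

theorem sum_bit {n m : ℕ} (v : YokeVertex n m) :
    v.left + ∑ k ∈ Finset.range m, ((v.bit k : ℤ) : ZMod n) + v.right = 0 := by
  rw [← v.sum_eq_zero, ← Fin.sum_univ_eq_sum_range]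
  simp [bit]

/-- The partial sums of the entries of `u` are those of `v` plus `D`. -/
def Displaced {n m : ℕ} (u v : YokeVertex n m) (D : ℕ → ℤ) : Prop :=
  u.left = v.left + (D 0 : ZMod n) ∧ ∀ k < m, u.bit k = v.bit k + D (k + 1) - D k

namespace Displaced

variable {n m : ℕ} {u v w : YokeVertex n m} {D E : ℕ → ℤ}

theorem right_eq (h : Displaced u v D) : u.right = v.right - (D m : ZMod n) := by
  have hu := u.sum_bit
  have hv := v.sum_bit
  have hs : ∑ k ∈ Finset.range m, ((u.bit k : ℤ) : ZMod n) =
      ∑ k ∈ Finset.range m, ((v.bit k : ℤ) : ZMod n) + ((D m : ZMod n) - (D 0 : ZMod n)) := by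
    rw [← Finset.sum_range_sub (fun k => (D k : ZMod n)), ← Finset.sum_add_distrib]
    refine Finset.sum_congr rfl fun k hk => ?_
    rw [h.2 k (Finset.mem_range.1 hk)]
    push_cast
    ring
  rw [hs, h.1] at hu
  linear_combination hu - hv

theorem trans (h : Displaced u v D) (h' : Displaced w u E) :
    Displaced w v (fun k => D k + E k) := by
  refine ⟨by rw [h'.1, h.1]; push_cast; ring, fun k hk => ?_⟩
  rw [h'.2 k hk, h.2 k hk]
  ring

theorem symm (h : Displaced u v D) : Displaced v u (fun k => -D k) := by
  refine ⟨by rw [h.1]; push_cast; ring, fun k hk => ?_⟩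
  rw [h.2 k hk]
  ring

theorem congr (h : Displaced u v D) (hE : ∀ k ≤ m, D k = E k) : Displaced u v E := by
  refine ⟨by rw [h.1, hE 0 (by omega)], fun k hk => ?_⟩
  rw [h.2 k hk, hE k (by omega), hE (k + 1) (by omega)]

theorem unique (h : Displaced u v D) (h' : Displaced w v D) : u = w :=
  ext_bit (by rw [h.1, h'.1]) fun k hk => by rw [h.2 k hk, h'.2 k hk]

/-- Only the middle entries constrain a displacement; the right bucket absorbs whatever remains. -/
theorem exists_of_bounds (v : YokeVertex n m) (D : ℕ → ℤ)
    (h : ∀ k < m, 0 ≤ v.bit k + D (k + 1) - D k ∧ v.bit k + D (k + 1) - D k ≤ 1) :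
    ∃ u, Displaced u v D := by
  let mid : Fin m → Fin 2 := fun k =>
    ⟨(v.bit k + D (k + 1) - D k).toNat, by have := h k k.isLt; omega⟩
  refine ⟨⟨v.left + D 0, mid, -(v.left + D 0 + ∑ i, ((mid i : ℕ) : ZMod n)), by ring⟩,
    rfl, fun k hk => ?_⟩
  rw [bit_of_lt _ hk]
  have := h k hk
  simp only [mid]
  omega

theorem const (h : Displaced v v D) {k : ℕ} (hk : k ≤ m) : D k = D 0 := by
  induction k with
  | zero => rfl
  | succ k ih =>
    have := h.2 k (by omega)
    have := ih (by omega)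
    omega

theorem cast_eq_zero (h : Displaced v v D) : (D 0 : ZMod n) = 0 := by
  simpa using h.1

/-- A displacement from a vertex to itself is a constant multiple of `n`; if nonzero, it has total
size at least `n(m+1) > 4`. This is why closed walks of length four lift to the integers. -/
theorem eq_zero (h : Displaced v v D) (hnm : 4 < n * (m + 1))
    (hD : ∑ k ∈ Finset.range (m + 1), |D k| ≤ 4) {k : ℕ} (hk : k ≤ m) : D k = 0 := by
  rw [h.const hk]
  by_contra h0
  have hdvd : (n : ℤ) ∣ D 0 := (ZMod.intCast_zmod_eq_zero_iff_dvd _ _).1 h.cast_eq_zero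
  have hle : (n : ℤ) ≤ |D 0| := Int.le_of_dvd (abs_pos.2 h0) ((dvd_abs _ _).2 hdvd)
  have hs : ∑ k ∈ Finset.range (m + 1), |D k| = ((m : ℤ) + 1) * |D 0| := by
    rw [Finset.sum_congr rfl fun k hk => by
      rw [h.const (k := k) (by have := Finset.mem_range.1 hk; omega)]]
    simp
  zify at hnm
  nlinarith

end Displaced

/-- Entry `j` is the difference of the partial sums `j` and `j - 1`. The conventions at the two ends
say that the empty sum and the total do not move. -/
theorem displaced_iff_entryEq {n m : ℕ} {u v : YokeVertex n m} {D : ℕ → ℤ}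
    (hD : D (m + 1) = 0) : Displaced u v D ↔
      ∀ j ≤ m + 1, u.EntryEq v j (D j - if j = 0 then 0 else D (j - 1)) := by
  constructor
  · intro h j hj
    unfold EntryEq
    split_ifs with h0 h1
    · rw [h.1, h0]; simp
    · have := h.2 _ h1
      rw [bit_of_lt _ h1, bit_of_lt _ h1, show j - 1 + 1 = j by omega] at this
      linarith
    · have : j = m + 1 := by omega
      rw [h.right_eq, this, hD]
      simp [sub_eq_add_neg]
  · intro h
    refine ⟨by simpa [EntryEq] using h 0 (by omega), fun k hk => ?_⟩
    have := h (k + 1) (by omega)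
    simp only [EntryEq, Nat.add_eq_zero_iff, one_ne_zero, and_false, if_false,
      Nat.add_sub_cancel, hk, dif_pos] at this
    rw [bit_of_lt _ hk, bit_of_lt _ hk]
    linarith

/-! ### Edges as labelled steps, degrees and squares -/

/-- `v.Step i u` says that `u` arises from `v` by changing the `i`-th partial sum by one. -/
def Step {n m : ℕ} (v : YokeVertex n m) (i : ℕ) (u : YokeVertex n m) : Prop :=
  i ≤ m ∧ ∃ ε : ℤ, (ε = 1 ∨ ε = -1) ∧ Displaced u v (fun k => if k = i then ε else 0)

theorem step_iff_shift {n m : ℕ} {u v : YokeVertex n m} {i : ℕ} :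
    v.Step i u ↔ i ≤ m ∧ u.Shift v i := by
  refine and_congr_right fun hi => ?_
  have key : ∀ ε : ℤ, Displaced u v (fun k => if k = i then ε else 0) ↔
      (∀ j ≤ m + 1, j ≠ i → j ≠ i + 1 → u.EntryEq v j 0) ∧
        u.EntryEq v i ε ∧ u.EntryEq v (i + 1) (-ε) := by
    intro ε
    rw [displaced_iff_entryEq (if_neg (by omega))]
    constructor
    · intro h
      refine ⟨fun j hj h1 h2 => ?_, ?_, ?_⟩
      · convert h j hj using 1
        split_ifs <;> omega
      · convert h i (by omega) using 1
        split_ifs <;> omega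
      · convert h (i + 1) (by omega) using 1
        simp
    · rintro ⟨h0, h1, h2⟩ j hj
      by_cases hji : j = i
      · subst hji
        convert h1 using 1
        split_ifs <;> omega
      · by_cases hji' : j = i + 1
        · subst hji'
          convert h2 using 1
          simp
        · convert h0 j hj hji hji' using 1
          split_ifs <;> omega
  unfold Shift
  constructor
  · rintro ⟨ε, rfl | rfl, h⟩
    · exact ⟨((key _).1 h).1, Or.inl ((key _).1 h).2⟩
    · exact ⟨((key _).1 h).1, Or.inr (by simpa using ((key _).1 h).2)⟩
  · rintro ⟨h0, h | h⟩
    · exact ⟨1, Or.inl rfl, (key _).2 ⟨h0, h⟩⟩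
    · exact ⟨-1, Or.inr rfl, (key _).2 ⟨h0, by simpa using h⟩⟩

namespace Step

variable {n m : ℕ} {u v w : YokeVertex n m} {i j : ℕ}

theorem symm (h : v.Step i u) : u.Step i v := by
  obtain ⟨hi, ε, hε, h⟩ := h
  refine ⟨hi, -ε, by omega, h.symm.congr fun k _ => ?_⟩
  split_ifs <;> simp

theorem ne (hm : 1 ≤ m) (h : v.Step i u) : u ≠ v := by
  rintro rfl
  obtain ⟨hi, ε, hε, h⟩ := h
  have h1 := h.const hi
  have h2 := h.const (k := if i = 0 then 1 else 0) (by split_ifs <;> omega)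
  split_ifs at h1 h2 <;> omega

theorem reverse (h : v.Step i u) : v.reverse.Step (m - i) u.reverse := by
  rw [step_iff_shift] at h ⊢
  exact ⟨by omega, h.2.reverse h.1⟩

/-- The direction of a step with a given label is forced. -/
theorem sign (hi : i ≤ m) {ε : ℤ} (hε : ε = 1 ∨ ε = -1)
    (h : Displaced u v (fun k => if k = i then ε else 0)) :
    (0 < i → ε = 1 - 2 * v.bit (i - 1)) ∧ (i < m → ε = 2 * v.bit i - 1) := by
  have hb := h.2
  dsimp only at hb
  constructor
  · intro h0
    have := hb (i - 1) (by omega)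
    have := u.bit_eq_zero_or_one (i - 1)
    have := v.bit_eq_zero_or_one (i - 1)
    split_ifs at * <;> omega
  · intro h0
    have := hb i h0
    have := u.bit_eq_zero_or_one i
    have := v.bit_eq_zero_or_one i
    split_ifs at * <;> omega

theorem unique (hm : 1 ≤ m) (h : v.Step i u) (h' : v.Step i w) : u = w := by
  obtain ⟨hi, ε, hε, h⟩ := h
  obtain ⟨-, δ, hδ, h'⟩ := h'
  have h1 := sign hi hε h
  have h2 := sign hi hδ h'
  have : ε = δ := by
    by_cases h0 : 0 < i
    · rw [h1.1 h0, h2.1 h0]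
    · rw [h1.2 (by omega), h2.2 (by omega)]
  subst this
  exact h.unique h'

theorem label_unique (hm : 2 ≤ m) (h : v.Step i u) (h' : v.Step j u) : i = j := by
  by_contra hij
  obtain ⟨hi, ε, hε, h⟩ := h
  obtain ⟨hj, δ, hδ, h'⟩ := h'
  have hc := h'.symm.trans h
  -- With at least three partial sums, some index avoids both labels. The difference of the two
  -- displacements is constant and vanishes there, yet it is ±1 at `i`.
  have : ∃ k ≤ m, k ≠ i ∧ k ≠ j := by
    by_cases h0 : 0 ≠ i ∧ 0 ≠ j
    · exact ⟨0, by omega, h0⟩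
    · by_cases h1 : 1 ≠ i ∧ 1 ≠ j
      · exact ⟨1, by omega, h1⟩
      · exact ⟨2, by omega, by omega, by omega⟩
  obtain ⟨k, hk, hki, hkj⟩ := this
  have h1 := hc.const hk
  have h2 := hc.const hi
  simp only [hki, hkj, hij, if_false, if_true] at h1 h2
  omega

end Step

/-- The labels of the steps from a vertex. -/
def Avail {n m : ℕ} (v : YokeVertex n m) (i : ℕ) : Prop :=
  i ≤ m ∧ (0 < i → i < m → v.bit (i - 1) ≠ v.bit i)

/-- The entries on either side of the changed sum each force its sign. At an inner label both must
agree, which means that these two entries differ; the labels 0 and `m` meet only one such condition.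
-/
theorem exists_step_iff {n m : ℕ} (hm : 1 ≤ m) (v : YokeVertex n m) (i : ℕ) :
    (∃ u, v.Step i u) ↔ v.Avail i := by
  constructor
  · rintro ⟨u, hi, ε, hε, h⟩
    refine ⟨hi, fun h0 h1 => ?_⟩
    have hs := Step.sign hi hε h
    have := hs.1 h0
    have := hs.2 h1
    have := v.bit_eq_zero_or_one i
    omega
  · rintro ⟨hi, h⟩
    have key : ∃ ε : ℤ, (ε = 1 ∨ ε = -1) ∧ (0 < i → ε = 1 - 2 * v.bit (i - 1)) ∧
        (i < m → ε = 2 * v.bit i - 1) := by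
      have := v.bit_eq_zero_or_one i
      have := v.bit_eq_zero_or_one (i - 1)
      by_cases h0 : 0 < i
      · exact ⟨1 - 2 * v.bit (i - 1), by omega, fun _ => rfl, fun h1 => by
          have := h h0 h1
          omega⟩
      · exact ⟨2 * v.bit i - 1, by omega, fun h1 => absurd h1 h0, fun _ => rfl⟩
    obtain ⟨ε, hε, h1, h2⟩ := key
    obtain ⟨u, hu⟩ := Displaced.exists_of_bounds v (fun k => if k = i then ε else 0) (by
      intro k hk
      have := v.bit_eq_zero_or_one k
      by_cases hki : k = i
      · subst hki
        have := h2 hk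
        simp
        omega
      · by_cases hki' : k + 1 = i
        · subst hki'
          have := h1 (by omega)
          simp at this ⊢
          omega
        · simp [hki, hki']
          omega)
    exact ⟨u, hi, ε, hε, hu⟩

theorem adj_iff_step {n m : ℕ} (hm : 1 ≤ m) {u v : YokeVertex n m} :
    (yokeGraph n m).Adj v u ↔ ∃ i, v.Step i u := by
  constructor
  · rintro ⟨-, i, hi, h⟩
    exact ⟨i, step_iff_shift.2 ⟨hi, h.symm⟩⟩
  · rintro ⟨i, h⟩
    exact ⟨(h.ne hm).symm, i, h.1, (step_iff_shift.1 h).2.symm⟩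

/-- The degree of a vertex counts the labels of its steps. -/
theorem ncard_neighborSet {n m : ℕ} (hm : 2 ≤ m) (v : YokeVertex n m) :
    ((yokeGraph n m).neighborSet v).ncard = {i | v.Avail i}.ncard := by
  have hex : ∀ i, ∃ u, v.Avail i → v.Step i u := fun i => by
    by_cases h : v.Avail i
    · obtain ⟨u, hu⟩ := (exists_step_iff (by omega) v i).2 h
      exact ⟨u, fun _ => hu⟩
    · exact ⟨v, fun h' => absurd h' h⟩
  choose g hg using hex
  have himg : (yokeGraph n m).neighborSet v = g '' {i | v.Avail i} := by
    ext u
    rw [SimpleGraph.mem_neighborSet, adj_iff_step (by omega)]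
    constructor
    · rintro ⟨i, h⟩
      have hi := (exists_step_iff (by omega) v i).1 ⟨u, h⟩
      exact ⟨i, hi, (hg i hi).unique (by omega) h⟩
    · rintro ⟨i, hi, rfl⟩
      exact ⟨i, hg i hi⟩
  rw [himg, Set.InjOn.ncard_image]
  intro i hi j hj hij
  have := hg j hj
  rw [← hij] at this
  exact (hg i hi).label_unique hm this

/-- Two neighbours of a vertex have at most one further common neighbour. -/
theorem Step.common_neighbor {n m : ℕ} (hm : 1 ≤ m) (hnm : 4 < n * (m + 1)) {v u u' z : YokeVertex n m}
    {i j : ℕ} (hij : i ≠ j) (hi : i ≤ m) (hj : j ≤ m) {ε δ : ℤ} (hε : ε = 1 ∨ ε = -1)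
    (hδ : δ = 1 ∨ δ = -1)
    (hu : Displaced u v (fun k => if k = i then ε else 0))
    (hu' : Displaced u' v (fun k => if k = j then δ else 0))
    (hz : (yokeGraph n m).Adj u z) (hz' : (yokeGraph n m).Adj u' z) :
    z = v ∨ Displaced z v (fun k => (if k = i then ε else 0) + if k = j then δ else 0) := by
  obtain ⟨k, hk, α, hα, h⟩ := (adj_iff_step hm).1 hz
  obtain ⟨l, hl, β, hβ, h'⟩ := (adj_iff_step hm).1 hz'
  have h1 := hu.trans h
  have h2 := hu'.trans h'
  have hc := h2.symm.trans h1
  have hb : ∀ (a : ℕ) (x : ℤ), (x = 1 ∨ x = -1) →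
      ∑ t ∈ Finset.range (m + 1), |if t = a then x else 0| ≤ 1 := by
    intro a x hx
    have : ∀ t, |if t = a then x else 0| = if t = a then 1 else 0 := by
      intro t
      split_ifs
      · rcases hx with rfl | rfl <;> simp
      · simp
    simp only [this, Finset.sum_ite_eq']
    split_ifs <;> simp
  -- The walk from `v` through `u`, `z`, `u'` back to `v` has four unit steps, so its total
  -- displacement vanishes. Comparing the coordinates `i` and `j` leaves two cases: `z` completes
  -- the square, or the steps to and from `u'` cancel and `z = v`.
  have hz0 := fun t ht => hc.eq_zero hnm (by
    refine le_trans (Finset.sum_le_sum fun t _ => (abs_add_le _ _).trans (add_le_add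
      ((abs_neg _).le.trans (abs_add_le _ _)) (abs_add_le _ _))) ?_
    simp only [Finset.sum_add_distrib]
    linarith [hb i ε hε, hb j δ hδ, hb k α hα, hb l β hβ]) (k := t) ht
  have hzi := hz0 i hi
  have hzj := hz0 j hj
  simp only [hij, hij.symm, if_true, if_false] at hzi hzj
  by_cases hkj : j = k
  · right
    refine h1.congr fun t ht => ?_
    have : α = δ := by
      by_cases hlj : j = l
      · simp only [← hkj, ← hlj, hij, if_true, if_false] at hzi hzj
        omega
      · simp only [← hkj, hlj, if_true, if_false] at hzj
        omega
    rw [hkj, this]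
  · left
    have hlj : j = l := by
      by_contra hlj
      simp only [hkj, hlj, if_false] at hzj
      omega
    simp only [hkj, ← hlj, if_true, if_false] at hzj
    have hβδ : β = -δ := by omega
    refine h2.unique (?_ : Displaced v v _)
    refine ⟨?_, fun t ht => ?_⟩
    · simp only [← hlj, hβδ]; split_ifs <;> simp
    · simp only [← hlj, hβδ]; split_ifs <;> simp

end YokeVertex

/-! ### Rigidity: spreading a fixed star -/

namespace YokeVertex

/-- `f` fixes `v` and all its neighbours. -/
def FixesStar {n m : ℕ} (f : YokeAut n m) (v : YokeVertex n m) : Prop :=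
  f v = v ∧ ∀ u, (yokeGraph n m).Adj v u → f u = u

/-- Squares through a fixed star force the new neighbours that they reach to be fixed. -/
theorem FixesStar.apply_eq_of_far {n m : ℕ} (hm : 1 ≤ m) (hnm : m = 1 ∨ 4 < n * (m + 1))
    {f : YokeAut n m} {v u z : YokeVertex n m} {i j : ℕ} (hv : FixesStar f v)
    (hu : v.Step i u) (hz : u.Step j z) (h1 : j + 1 ≠ i) (h2 : j ≠ i + 1) : f z = z := by
  by_cases hji : j = i
  · subst hji
    rw [hz.unique hm hu.symm]
    exact hv.1
  have hfu : f u = u := hv.2 u ((adj_iff_step hm).2 ⟨i, hu⟩)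
  have hzadj : (yokeGraph n m).Adj u z := (adj_iff_step hm).2 ⟨j, hz⟩
  obtain ⟨hi, ε, hε, hu⟩ := hu
  obtain ⟨hj, δ, hδ, hz⟩ := hz
  -- For `m = 1` the only distinct labels, 0 and 1, are consecutive, which is excluded here.
  have hnm : 4 < n * (m + 1) := by omega
  have hzv := hu.trans hz
  -- Non-consecutive labels touch no common middle entry, so each middle entry of `y` is the one of
  -- `v` or of `z`.
  obtain ⟨y, hy⟩ := Displaced.exists_of_bounds v (fun k => if k = j then δ else 0) (by
    intro k hk
    have hzk := hzv.2 k hk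
    have := v.bit_eq_zero_or_one k
    have := z.bit_eq_zero_or_one k
    dsimp only at hzk ⊢
    split_ifs at hzk ⊢ <;> omega)
  have hyz : (yokeGraph n m).Adj y z := by
    refine (adj_iff_step hm).2 ⟨i, hi, ε, hε, (hy.symm.trans hzv).congr fun k _ => ?_⟩
    ring
  have hfy : f y = y := hv.2 y ((adj_iff_step hm).2 ⟨j, hj, δ, hδ, hy⟩)
  have hz1 : (yokeGraph n m).Adj u (f z) := hfu ▸ f.map_adj_iff.2 hzadj
  have hz2 : (yokeGraph n m).Adj y (f z) := hfy ▸ f.map_adj_iff.2 hyz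
  rcases Step.common_neighbor hm hnm (Ne.symm hji) hi hj hε hδ hu hy hz1 hz2 with h | h
  · exact f.injective (by rw [h, hv.1])
  · exact h.unique hzv

/-- A fixed star spreads along a step if the new neighbours carry at most one label. -/
theorem FixesStar.step {n m : ℕ} (hm : 1 ≤ m) (hnm : m = 1 ∨ 4 < n * (m + 1))
    {f : YokeAut n m} {v u : YokeVertex n m} {i : ℕ} (hv : FixesStar f v)
    (hu : v.Step i u) (p : ℕ)
    (hp : ∀ j z, u.Step j z → j + 1 = i ∨ j = i + 1 → j ≠ p → f z = z) : FixesStar f u := by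
  have hfu : f u = u := hv.2 u ((adj_iff_step hm).2 ⟨i, hu⟩)
  have key : ∀ j z, u.Step j z → j ≠ p → f z = z := by
    intro j z hz hj
    by_cases hji : j + 1 = i ∨ j = i + 1
    · exact hp j z hz hji hj
    · exact hv.apply_eq_of_far hm hnm hu hz (by omega) (by omega)
  refine ⟨hfu, fun z hz => ?_⟩
  obtain ⟨j, hj⟩ := (adj_iff_step hm).1 hz
  by_cases hjp : j = p
  · have hfz : (yokeGraph n m).Adj u (f z) := hfu ▸ f.map_adj_iff.2 hz
    obtain ⟨k, hk⟩ := (adj_iff_step hm).1 hfz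
    by_cases hkp : k = p
    · subst hkp hjp
      exact hk.unique hm hj
    -- An image carrying another label is itself fixed by `f`, so injectivity forces it to equal
    -- `z`.
    · exact f.injective (key k _ hk hkp)
  · exact key j z hj hjp

theorem ncard_ne_of_differ_at {A B : Set ℕ} (hA : A.Finite) (hB : B.Finite) {a : ℕ}
    (ha : a ∈ A ↔ a ∉ B) (h : ∀ i, i ≠ a → (i ∈ A ↔ i ∈ B)) : A.ncard ≠ B.ncard := by
  wlog haA : a ∈ A generalizing A B
  · exact (this hB hA (by tauto) (fun i hi => (h i hi).symm) (by tauto)).symm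
  have : A = insert a B := by
    ext i
    by_cases hi : i = a
    · simp [hi, haA]
    · simp [hi, h i hi]
  rw [this, Set.ncard_insert_of_notMem (ha.1 haA) hB]
  omega

theorem finite_avail {n m : ℕ} (v : YokeVertex n m) : {i | v.Avail i}.Finite :=
  (Set.finite_Iic m).subset fun _ h => h.1

theorem ncard_neighborSet_apply {n m : ℕ} (f : YokeAut n m) (v : YokeVertex n m) :
    ((yokeGraph n m).neighborSet (f v)).ncard = ((yokeGraph n m).neighborSet v).ncard :=
  (Nat.card_congr (f.mapNeighborSet v)).symm

/-- A fixed star spreads along the step `100… → 010…`. -/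
theorem FixesStar.step_one {n m : ℕ} (hm : 3 ≤ m) (hnm : 4 < n * (m + 1))
    {f : YokeAut n m} {v u : YokeVertex n m} (hv : FixesStar f v) (hu : v.Step 1 u)
    (h0 : u.bit 0 = 0) (h1 : u.bit 1 = 1) (h2 : u.bit 2 = 0) : FixesStar f u := by
  have hfu : f u = u := hv.2 u ((adj_iff_step (by omega)).2 ⟨1, hu⟩)
  refine hv.step (by omega) (Or.inr hnm) hu 2 fun j z hz hj hj2 => ?_
  obtain rfl : j = 0 := by omega
  have hadj : (yokeGraph n m).Adj u z := (adj_iff_step (by omega)).2 ⟨0, hz⟩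
  have hfz : (yokeGraph n m).Adj u (f z) := hfu ▸ f.map_adj_iff.2 hadj
  obtain ⟨k, hk⟩ := (adj_iff_step (by omega)).1 hfz
  by_cases hk0 : k = 0
  · subst hk0
    exact hk.unique (by omega) hz
  by_cases hk2 : k ≠ 2
  · exact f.injective (hv.apply_eq_of_far (by omega) (Or.inr hnm) hu hk (by omega) (by omega))
  exfalso
  obtain rfl : k = 2 := by omega
  obtain ⟨-, ε, hε, hz⟩ := hz
  obtain ⟨-, δ, hδ, hk⟩ := hk
  obtain rfl : ε = -1 := by
    have := (Step.sign (by omega) hε hz).2 (by omega)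
    omega
  obtain rfl : δ = -1 := by
    have := (Step.sign (by omega) hδ hk).2 (by omega)
    omega
  -- The remaining threat is that `f` sends `z = 110…` to `001…`. For `m ≥ 4` these have different
  -- degrees: the inner label 3 is available at exactly one of them, and all other labels agree.
  by_cases hm4 : 4 ≤ m
  · have hz' := hz.2
    have hk' := hk.2
    dsimp only at hz' hk'
    have a0 := hz' 0 (by omega)
    have a1 := hz' 1 (by omega)
    have a2 := hz' 2 (by omega)
    have a3 := hz' 3 (by omega)
    have b0 := hk' 0 (by omega)
    have b1 := hk' 1 (by omega)
    have b2 := hk' 2 (by omega)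
    have b3 := hk' 3 (by omega)
    have hbig : ∀ i, 3 ≤ i → i < m → z.bit i = (f z).bit i := by
      intro i hi him
      have h1 := hz' i him
      have h2 := hk' i him
      split_ifs at h1 h2 <;> first | omega | contradiction
    norm_num at a0 a1 a2 a3 b0 b1 b2 b3
    have hcard := ncard_neighborSet_apply f z
    rw [ncard_neighborSet (by omega), ncard_neighborSet (by omega)] at hcard
    refine ncard_ne_of_differ_at (finite_avail _) (finite_avail _) (a := 3) ?_ ?_ hcard
    · have := u.bit_eq_zero_or_one 3
      simp only [Avail, Set.mem_ofPred_eq]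
      norm_num
      omega
    · intro i hi
      simp only [Avail, Set.mem_ofPred_eq]
      rcases (by omega : i = 0 ∨ i = 1 ∨ i = 2 ∨ 4 ≤ i) with rfl | rfl | rfl | hi4
      · simp
      · norm_num
        omega
      · norm_num
        omega
      · by_cases him : i < m
        · rw [hbig i (by omega) him, hbig (i - 1) (by omega) (by omega)]
        · simp [him]
  · obtain rfl : m = 3 := by omega
    -- For `m = 3` the label 3 is always available, so degrees do not help. But `z` and the fixed
    -- vertex `y` have a common neighbour `t` other than `u`, because the labels 0 and 3 commute.
    -- Its image would have to complete a square on the labels 2 and 3, giving the last middle entry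
    -- the value 2.
    obtain ⟨y, hy⟩ := (exists_step_iff (by omega) u 3).2 ⟨le_rfl, by omega⟩
    have hfy : f y = y :=
      hv.apply_eq_of_far (by omega) (Or.inr hnm) hu hy (by omega) (by omega)
    obtain ⟨-, γ, hγ, hy⟩ := hy
    obtain ⟨t, ht⟩ := Displaced.exists_of_bounds u
      (fun k => (if k = 0 then -1 else 0) + if k = 3 then γ else 0) (by
        intro k hk
        have hy' := hy.2 k hk
        have hz' := hz.2 k hk
        have := u.bit_eq_zero_or_one k
        have := z.bit_eq_zero_or_one k
        have := y.bit_eq_zero_or_one k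
        dsimp only at hz' hy' ⊢
        split_ifs at hz' hy' ⊢ <;> first | omega | contradiction)
    have hzt : (yokeGraph n 3).Adj z t := by
      refine (adj_iff_step (by omega)).2 ⟨3, le_rfl, γ, hγ, (hz.symm.trans ht).congr fun k _ => ?_⟩
      ring
    have hyt : (yokeGraph n 3).Adj y t := by
      refine (adj_iff_step (by omega)).2 ⟨0, by omega, -1, Or.inr rfl,
        (hy.symm.trans ht).congr fun k _ => ?_⟩
      ring
    rcases Step.common_neighbor (by omega) hnm (by omega) (by omega) le_rfl (Or.inr rfl) hγ hk hy
      (f.map_adj_iff.2 hzt) (hfy ▸ f.map_adj_iff.2 hyt) with h | h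
    · have htu : t = u := f.injective (by rw [h, hfu])
      subst htu
      have c1 := ht.const (k := 1) (by omega)
      norm_num at c1
    · have hb := h.2 2 (by omega)
      have hs := (Step.sign le_rfl hγ hy).1 (by omega)
      have := (f t).bit_eq_zero_or_one 2
      norm_num at hb hs
      omega

/-- The vertex `(-r, 0, …, 0, r)`. -/
def zeroVertex {n : ℕ} (m : ℕ) (r : ZMod n) : YokeVertex n m where
  left := -r
  mid := fun _ => 0
  right := r
  sum_eq_zero := by simp

theorem bit_zeroVertex {n m : ℕ} (r : ZMod n) (k : ℕ) : (zeroVertex m r).bit k = 0 := by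
  simp [bit, zeroVertex]

theorem eq_zeroVertex {n m : ℕ} {v : YokeVertex n m} (h : ∀ k < m, v.bit k = 0) :
    v = zeroVertex m v.right := by
  refine ext_bit ?_ fun k hk => by rw [h k hk, bit_zeroVertex]
  have hs := v.sum_bit
  rw [Finset.sum_eq_zero fun k hk => by rw [h k (Finset.mem_range.1 hk)]; simp] at hs
  change v.left = -v.right
  linear_combination hs

/-- Summation by parts. It shows that raising one partial sum of index below `m` lowers the weight
`∑ (k+1) v_{k+1}` by one. -/
theorem sum_succ_mul_sub (D : ℕ → ℤ) (M : ℕ) :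
    ∑ k ∈ Finset.range M, ((k : ℤ) + 1) * (D (k + 1) - D k) =
      M * D M - ∑ k ∈ Finset.range M, D k := by
  induction M with
  | zero => simp
  | succ M ih =>
    rw [Finset.sum_range_succ, Finset.sum_range_succ, ih]
    push_cast
    ring

/-- A fixed star at `(-r, 0, …, 0, r)` spreads to all vertices with the same right entry. -/
theorem FixesStar.of_zeroVertex {n m : ℕ} (hm : 1 ≤ m) (hnm : m = 1 ∨ 3 ≤ m ∧ 4 < n * (m + 1))
    {f : YokeAut n m} {r : ZMod n} (hr : FixesStar f (zeroVertex m r)) (N : ℕ) :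
    ∀ v : YokeVertex n m, v.right = r →
      ∑ k ∈ Finset.range m, ((k : ℤ) + 1) * v.bit k = N → FixesStar f v := by
  have hnm' : m = 1 ∨ 4 < n * (m + 1) := by tauto
  induction N with
  | zero =>
    intro v hvr hN
    have hz : ∀ k < m, v.bit k = 0 := by
      intro k hk
      have h0 := (Finset.sum_eq_zero_iff_of_nonneg (fun k _ => mul_nonneg (by positivity) (by
        have := v.bit_eq_zero_or_one k
        omega))).1 hN k (Finset.mem_range.2 hk)
      rcases mul_eq_zero.1 h0 with h | h
      · omega
      · exact h
    rw [eq_zeroVertex hz, hvr]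
    exact hr
  | succ N ih =>
    intro v hvr hN
    have hex : ∃ p, p < m ∧ v.bit p = 1 := by
      by_contra hcon
      push Not at hcon
      rw [Finset.sum_eq_zero fun k hk => by
        have := hcon k (Finset.mem_range.1 hk)
        have := v.bit_eq_zero_or_one k
        rw [show v.bit k = 0 by omega, mul_zero]] at hN
      push_cast at hN
      omega
    classical
    obtain ⟨p, ⟨hpm, hp1⟩, hmin⟩ : ∃ p, (p < m ∧ v.bit p = 1) ∧ ∀ k < p, v.bit k = 0 := by
      refine ⟨Nat.find hex, Nat.find_spec hex, fun k hk => ?_⟩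
      have h1 := Nat.find_min hex hk
      have h2 := (Nat.find_spec hex).1
      have := v.bit_eq_zero_or_one k
      by_contra h0
      exact h1 ⟨by omega, by omega⟩
    -- Moving the leftmost 1 one place to the left, or into the left bucket, lowers the weight by
    -- one and keeps the right entry.
    obtain ⟨w, hw⟩ := Displaced.exists_of_bounds v (fun k => if k = p then 1 else 0) (by
      intro k hk
      have := v.bit_eq_zero_or_one k
      have := hmin k
      by_cases hkp : k = p
      · subst hkp
        simp [hp1]
      · by_cases hkp' : k + 1 = p
        · simp [hkp, hkp', hmin k (by omega)]
        · simp [hkp, hkp']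
          omega)
    have hstep : w.Step p v := Step.symm ⟨by omega, 1, Or.inl rfl, hw⟩
    have hgw : FixesStar f w := by
      refine ih w ?_ ?_
      · rw [hw.right_eq, hvr, if_neg (by omega)]
        simp
      · have hsum := sum_succ_mul_sub (fun k => if k = p then 1 else 0) m
        rw [Finset.sum_ite_eq', if_pos (Finset.mem_range.2 hpm), if_neg (by omega)] at hsum
        rw [Finset.sum_congr rfl fun k hk => by
          rw [hw.2 k (Finset.mem_range.1 hk), add_sub_assoc, mul_add],
          Finset.sum_add_distrib, hN, hsum]
        push_cast
        ring
    have havail : ∀ {j z}, v.Step j z → v.Avail j := fun h =>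
      (exists_step_iff hm v _).1 ⟨_, h⟩
    -- Going back from `w` to `v`, the new labels can only be `p - 1` and `p + 1`. For `p ≥ 2` the
    -- former is blocked by two zeros, and for `p = 0` it does not exist. For `p = 1` it is the end
    -- label 0, so either `p + 1` is blocked by two ones or `step_one` is needed.
    by_cases hp : p = 1
    · subst hp
      by_cases hb2 : v.bit 2 = 0
      · exact hgw.step_one (by omega) (by omega) hstep (hmin 0 (by omega)) hp1 hb2
      · refine hgw.step hm hnm' hstep 0 fun j z hz hj hj0 => ?_
        obtain rfl : j = 2 := by omega
        have := (havail hz).2 (by omega) (by omega)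
        have := v.bit_eq_zero_or_one 2
        norm_num at *
        omega
    · refine hgw.step hm hnm' hstep (p + 1) fun j z hz hj hj0 => ?_
      obtain rfl : p = j + 1 := by omega
      exact absurd ((hmin (j - 1) (by omega)).trans (hmin j (by omega)).symm)
        ((havail hz).2 (by omega) (by omega))

/-- An automorphism fixing a degree two vertex and its neighbours is trivial. -/
theorem eq_one_of_fixesStar {n m : ℕ} (hn : 1 ≤ n) (hm : 1 ≤ m)
    (hnm : m = 1 ∨ 3 ≤ m ∧ 4 < n * (m + 1)) {f : YokeAut n m}
    (h0 : FixesStar f (zeroVertex m 0)) : f = 1 := by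
  have hspread : ∀ r : ZMod n, FixesStar f (zeroVertex m r) →
      ∀ v : YokeVertex n m, v.right = r → FixesStar f v := by
    intro r hr v hv
    have hnn : 0 ≤ ∑ k ∈ Finset.range m, ((k : ℤ) + 1) * v.bit k :=
      Finset.sum_nonneg fun k _ => mul_nonneg (by positivity) (by
        have := v.bit_eq_zero_or_one k
        omega)
    exact hr.of_zeroVertex hm hnm _ v hv (Int.toNat_of_nonneg hnn).symm
  have hall : ∀ k : ℕ, FixesStar f (zeroVertex m (k : ZMod n)) := by
    intro k
    induction k with
    | zero => simpa using h0
    | succ k ih =>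
      -- Taking a unit out of the right bucket links the class of right entry `k + 1` to that of
      -- `k`. The only possible new label on the way back is `m - 1`.
      obtain ⟨w, hw⟩ := (exists_step_iff hm (zeroVertex m ((k + 1 : ℕ) : ZMod n)) m).2
        ⟨le_rfl, by omega⟩
      have hwr : w.right = (k : ZMod n) := by
        obtain ⟨-, ε, hε, h⟩ := hw
        have hs := (Step.sign le_rfl hε h).1 (by omega)
        rw [bit_zeroVertex] at hs
        rw [h.right_eq, if_pos rfl, hs]
        simp [zeroVertex]
      refine (hspread _ ih w hwr).step hm (by tauto) hw.symm (m - 1) fun j z hz hj hj' => ?_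
      have := hz.1
      omega
  have : NeZero n := ⟨by omega⟩
  ext1 v
  have hv := hall v.right.val
  rw [ZMod.natCast_zmod_val] at hv
  exact (hspread _ hv v rfl).1

end YokeVertex

/-! ### Recognition of dihedral groups and of products with the group of order two -/

namespace DihedralGroup

variable {G : Type*} [Group G] {N : ℕ} {g h t : G}

theorem zpow_cast_eq (hg : g ^ N = 1) (a : ℤ) : g ^ ((a : ZMod N).cast : ℤ) = g ^ a := by
  have h1 : (((a : ZMod N).cast : ℤ) : ZMod N) = (a : ZMod N) := by simp
  obtain ⟨c, hc⟩ := (ZMod.intCast_eq_intCast_iff_dvd_sub _ _ _).1 h1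
  rw [show a = ((a : ZMod N).cast : ℤ) + N * c by linarith, zpow_add, zpow_mul, zpow_natCast, hg,
    one_zpow, mul_one]
  simp

theorem zpow_mul_reflection (hh : h * h = 1) (hgh : h * g * h = g⁻¹) (k : ℤ) :
    g ^ k * h = h * g ^ (-k) := by
  have hinv : h⁻¹ = h := inv_eq_of_mul_eq_one_right hh
  have h1 : h * g ^ k * h⁻¹ = g ^ (-k) := by
    rw [← conj_zpow, hinv, hgh, inv_zpow, zpow_neg]
  rw [← h1, hinv, ← mul_assoc, ← mul_assoc, hh, one_mul]

/-- The homomorphism from a dihedral group given by a rotation and a reflection. -/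
def lift (hg : g ^ N = 1) (hh : h * h = 1) (hgh : h * g * h = g⁻¹) : DihedralGroup N →* G where
  toFun
    | r i => g ^ (i.cast : ℤ)
    | sr i => h * g ^ (i.cast : ℤ)
  map_one' := by
    change g ^ ((0 : ZMod N).cast : ℤ) = 1
    simp
  map_mul' := by
    have key := zpow_mul_reflection hh hgh
    rintro (i | i) (j | j) <;> obtain ⟨a, rfl⟩ := ZMod.intCast_surjective i <;>
      obtain ⟨b, rfl⟩ := ZMod.intCast_surjective j
    · rw [r_mul_r, ← Int.cast_add]
      simp only [zpow_cast_eq hg, zpow_add]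
    · rw [r_mul_sr, ← Int.cast_sub]
      simp only [zpow_cast_eq hg]
      rw [← mul_assoc, key, mul_assoc, ← zpow_add]
      congr 2
      ring
    · rw [sr_mul_r, ← Int.cast_add]
      simp only [zpow_cast_eq hg, zpow_add, mul_assoc]
    · rw [sr_mul_sr, ← Int.cast_sub]
      simp only [zpow_cast_eq hg]
      rw [mul_assoc, ← mul_assoc _ h, key, ← mul_assoc, ← mul_assoc, hh, one_mul, ← zpow_add]
      congr 1
      ring

theorem lift_r (hg : g ^ N = 1) (hh : h * h = 1) (hgh : h * g * h = g⁻¹) (a : ℤ) :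
    lift hg hh hgh (r (a : ZMod N)) = g ^ a := zpow_cast_eq hg a

theorem lift_sr (hg : g ^ N = 1) (hh : h * h = 1) (hgh : h * g * h = g⁻¹) (a : ℤ) :
    lift hg hh hgh (sr (a : ZMod N)) = h * g ^ a := congrArg (h * ·) (zpow_cast_eq hg a)

theorem lift_injective (hg : g ^ N = 1) (hh : h * h = 1) (hgh : h * g * h = g⁻¹)
    (h1 : ∀ k : ℤ, g ^ k = 1 → (N : ℤ) ∣ k) (h2 : ∀ k : ℤ, g ^ k ≠ h) :
    Function.Injective (lift hg hh hgh) := by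
  rw [injective_iff_map_eq_one]
  rintro (i | i) hi <;> obtain ⟨a, rfl⟩ := ZMod.intCast_surjective i
  · rw [lift_r] at hi
    rw [(ZMod.intCast_zmod_eq_zero_iff_dvd _ _).2 (h1 a hi), r_zero]
  · rw [lift_sr] at hi
    refine absurd ?_ (h2 a)
    have := congrArg (h * ·) hi
    simpa [← mul_assoc, hh] using this

/-- Recognition of a dihedral group by generators and relations. -/
theorem nonempty_mulEquiv (hg : g ^ N = 1) (hh : h * h = 1) (hgh : h * g * h = g⁻¹)
    (h1 : ∀ k : ℤ, g ^ k = 1 → (N : ℤ) ∣ k) (h2 : ∀ k : ℤ, g ^ k ≠ h)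
    (htop : Subgroup.closure {g, h} = ⊤) : Nonempty (G ≃* DihedralGroup N) := by
  refine ⟨(MulEquiv.ofBijective (lift hg hh hgh) ⟨lift_injective hg hh hgh h1 h2, ?_⟩).symm⟩
  rw [← MonoidHom.range_eq_top, eq_top_iff, ← htop, Subgroup.closure_le]
  rintro x (rfl | rfl)
  · exact ⟨r ((1 : ℤ) : ZMod N), by rw [lift_r, zpow_one]⟩
  · exact ⟨sr ((0 : ℤ) : ZMod N), by rw [lift_sr, zpow_zero, mul_one]⟩

end DihedralGroup

/-- The homomorphism from the group of order two given by an involution. -/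
def CyclicTwo.lift {G : Type*} [Group G] {t : G} (ht : t * t = 1) : CyclicTwo →* G where
  toFun c := t ^ (Multiplicative.toAdd c).val
  map_one' := by simp
  map_mul' := by
    have : ∀ a b : ZMod 2, t ^ (a + b).val = t ^ a.val * t ^ b.val := by
      intro a b
      fin_cases a <;> fin_cases b
      · change t ^ 0 = t ^ 0 * t ^ 0
        simp
      · change t ^ 1 = t ^ 0 * t ^ 1
        simp
      · change t ^ 1 = t ^ 1 * t ^ 0
        simp
      · change t ^ 0 = t ^ 1 * t ^ 1
        simp [ht]
    exact fun a b => this _ _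

theorem CyclicTwo.eq_one_or (c : CyclicTwo) : c = 1 ∨ c = Multiplicative.ofAdd (1 : ZMod 2) := by
  revert c
  decide

theorem CyclicTwo.lift_generator {G : Type*} [Group G] {t : G} (ht : t * t = 1) :
    CyclicTwo.lift ht (Multiplicative.ofAdd (1 : ZMod 2)) = t := by
  change t ^ 1 = t
  simp

theorem CyclicTwo.nonempty_mulEquiv {G : Type*} [Group G] {t : G} (ht : t ≠ 1)
    (htop : ∀ x : G, x = 1 ∨ x = t) : Nonempty (G ≃* CyclicTwo) := by
  have htt : t * t = 1 := (htop (t * t)).resolve_right fun h => ht (by simpa using h)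
  refine ⟨(MulEquiv.ofBijective (CyclicTwo.lift htt) ⟨?_, fun x => ?_⟩).symm⟩
  · rw [injective_iff_map_eq_one]
    intro c hc
    rcases CyclicTwo.eq_one_or c with rfl | rfl
    · rfl
    · rw [CyclicTwo.lift_generator] at hc
      exact absurd hc ht
  · rcases htop x with rfl | rfl
    · exact ⟨1, map_one _⟩
    · exact ⟨_, CyclicTwo.lift_generator htt⟩

/-- Recognition of the product of a dihedral group and a group of order two. -/
theorem DihedralGroup.nonempty_mulEquiv_prod {G : Type*} [Group G] {N : ℕ} {g h t : G}
    (hg : g ^ N = 1) (hh : h * h = 1) (hgh : h * g * h = g⁻¹) (ht : t * t = 1)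
    (htg : Commute t g) (hth : Commute t h)
    (h1 : ∀ k : ℤ, g ^ k = 1 → (N : ℤ) ∣ k) (h2 : ∀ k : ℤ, g ^ k ≠ h)
    (h3 : ∀ k : ℤ, g ^ k ≠ t) (h4 : ∀ k : ℤ, g ^ k ≠ h * t)
    (htop : Subgroup.closure {g, h, t} = ⊤) :
    Nonempty (G ≃* DihedralGroup N × CyclicTwo) := by
  have hcomm : ∀ x c, Commute (lift hg hh hgh x) (CyclicTwo.lift ht c) := by
    intro x c
    have hx : Commute t (lift hg hh hgh x) := by
      rcases x with i | i
      · exact htg.zpow_right _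
      · exact hth.mul_right (htg.zpow_right _)
    exact (hx.pow_left _).symm
  let F := MonoidHom.noncommCoprod (lift hg hh hgh) (CyclicTwo.lift ht) hcomm
  have hF : ∀ x c, F (x, c) = lift hg hh hgh x * CyclicTwo.lift ht c := fun x c => rfl
  have hinv : t⁻¹ = t := inv_eq_of_mul_eq_one_right ht
  refine ⟨(MulEquiv.ofBijective F ⟨?_, ?_⟩).symm⟩
  · rw [injective_iff_map_eq_one]
    rintro ⟨x, c⟩ hx
    rw [hF] at hx
    rcases CyclicTwo.eq_one_or c with rfl | rfl
    · rw [map_one, mul_one] at hx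
      rw [(injective_iff_map_eq_one _).1 (lift_injective hg hh hgh h1 h2) x hx]
      rfl
    · rw [CyclicTwo.lift_generator] at hx
      have hx := eq_inv_of_mul_eq_one_left hx
      rw [hinv] at hx
      rcases x with i | i <;> obtain ⟨a, rfl⟩ := ZMod.intCast_surjective i
      · rw [lift_r] at hx
        exact absurd hx (h3 a)
      · rw [lift_sr] at hx
        refine absurd ?_ (h4 a)
        rw [← hx, ← mul_assoc, hh, one_mul]
  · rw [← MonoidHom.range_eq_top, eq_top_iff, ← htop, Subgroup.closure_le]
    rintro x (rfl | rfl | rfl)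
    · exact ⟨(r ((1 : ℤ) : ZMod N), 1), by rw [hF, lift_r, map_one, mul_one, zpow_one]⟩
    · exact ⟨(sr ((0 : ℤ) : ZMod N), 1), by
        rw [hF, lift_sr, map_one, mul_one, zpow_zero, mul_one]⟩
    · exact ⟨(1, _), by rw [hF, map_one, one_mul, CyclicTwo.lift_generator]⟩

/-! ### The abstract group generated by the fundamental automorphisms -/

/-- The relations between the three fundamental automorphisms. -/
structure YokeRelations {G : Type*} [Group G] (n m : ℕ) (φ ψ τ : G) : Prop where
  phi_pow : φ ^ n = 1
  psi_mul_self : ψ * ψ = 1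
  tau_mul_self : τ * τ = 1
  psi_conj : ψ * φ * ψ = φ⁻¹
  tau_conj : τ * φ * τ = φ⁻¹
  psi_mul_tau : ψ * τ = φ ^ (-m : ℤ) * (τ * ψ)
  dvd_of_zpow : ∀ k : ℤ, φ ^ k = 1 → (n : ℤ) ∣ k
  zpow_ne_psi : ∀ k : ℤ, φ ^ k ≠ ψ
  zpow_ne_tau : ∀ k : ℤ, φ ^ k ≠ τ
  zpow_ne_tau_mul_psi : ∀ k : ℤ, φ ^ k ≠ τ * ψ
  closure_eq_top : Subgroup.closure {φ, ψ, τ} = ⊤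

namespace YokeRelations

variable {G : Type*} [Group G] {n m : ℕ} {φ ψ τ : G}

/-- Both `τ` and `ψ` invert `φ`, so their product centralizes it. -/
theorem commute (h : YokeRelations n m φ ψ τ) : Commute (τ * ψ) φ := by
  have h1 := DihedralGroup.zpow_mul_reflection h.psi_mul_self h.psi_conj 1
  have h2 := DihedralGroup.zpow_mul_reflection h.tau_mul_self h.tau_conj 1
  have h3 := DihedralGroup.zpow_mul_reflection h.psi_mul_self h.psi_conj (-1)
  simp only [zpow_one, neg_neg] at h1 h2 h3
  change τ * ψ * φ = φ * (τ * ψ)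
  rw [← mul_assoc, h2, mul_assoc, mul_assoc, h3]

theorem tau_mul_psi_sq (h : YokeRelations n m φ ψ τ) : (τ * ψ) * (τ * ψ) = φ ^ (m : ℤ) := by
  have h2 := DihedralGroup.zpow_mul_reflection h.tau_mul_self h.tau_conj (m : ℤ)
  rw [mul_assoc, ← mul_assoc ψ, h.psi_mul_tau, mul_assoc, mul_assoc, h.psi_mul_self, mul_one,
    ← mul_assoc, ← h2, mul_assoc, h.tau_mul_self, mul_one]

/-- The element `τψφ^j` and its relations. -/
theorem twist (h : YokeRelations n m φ ψ τ) (j : ℤ) :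
    (τ * ψ * φ ^ j) * (τ * ψ * φ ^ j) = φ ^ (m + 2 * j) ∧
      ψ * (τ * ψ * φ ^ j) * ψ = (τ * ψ * φ ^ j)⁻¹ := by
  have hc := h.commute.zpow_right j
  constructor
  · rw [mul_assoc, ← mul_assoc (φ ^ j), ← hc.eq, ← mul_assoc, ← mul_assoc, h.tau_mul_psi_sq,
      ← zpow_add, ← zpow_add]
    congr 1
    ring
  · have h1 := DihedralGroup.zpow_mul_reflection h.psi_mul_self h.psi_conj j
    have hψ : ψ⁻¹ = ψ := inv_eq_of_mul_eq_one_right h.psi_mul_self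
    have hτ : τ⁻¹ = τ := inv_eq_of_mul_eq_one_right h.tau_mul_self
    rw [mul_inv_rev, mul_inv_rev, hψ, hτ, ← zpow_neg, mul_assoc, mul_assoc, h1,
      mul_assoc τ, ← mul_assoc ψ ψ, h.psi_mul_self, one_mul, ← mul_assoc]
    have h2 := h.commute.inv_left.zpow_right (-j)
    rw [mul_inv_rev, hψ, hτ] at h2
    exact h2.eq

theorem zpow_ne_twist (h : YokeRelations n m φ ψ τ) (j k : ℤ) : φ ^ k ≠ τ * ψ * φ ^ j := by
  intro hk
  refine h.zpow_ne_tau_mul_psi (k - j) ?_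
  rw [zpow_sub, hk, mul_inv_cancel_right]

theorem nonempty_mulEquiv_dihedral (h : YokeRelations n m φ ψ τ) (hodd : Odd n ∨ Odd m) :
    Nonempty (G ≃* DihedralGroup (2 * n)) := by
  -- One needs `m + 2j ≡ 1` modulo `n`. If `n = 2k + 1`, then `k + 1` is an inverse of 2; if `m = 2k
  -- + 1`, then `j = -k` works over the integers.
  have hj : ∃ j : ℤ, φ ^ ((m : ℤ) + 2 * j) = φ := by
    rcases hodd with ⟨k, hk⟩ | ⟨k, hk⟩
    · refine ⟨(1 - m) * (k + 1), ?_⟩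
      have : (m : ℤ) + 2 * ((1 - m) * (k + 1)) = n * (1 - m) + 1 := by
        rw [hk]
        push_cast
        ring
      rw [this, zpow_add, zpow_mul, zpow_natCast, h.phi_pow, one_zpow, one_mul, zpow_one]
    · refine ⟨-k, ?_⟩
      rw [hk]
      push_cast
      rw [show (2 * (k : ℤ) + 1 + 2 * -k) = 1 by ring, zpow_one]
  obtain ⟨j, hj⟩ := hj
  obtain ⟨hsq, hconj⟩ := h.twist j
  have hne := h.zpow_ne_twist j
  rw [hj] at hsq
  set ρ := τ * ψ * φ ^ j with hρ
  have hpow : ∀ a : ℤ, ρ ^ (2 * a) = φ ^ a := by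
    intro a
    rw [zpow_mul, zpow_two, hsq]
  refine DihedralGroup.nonempty_mulEquiv (g := ρ) (h := ψ) ?_ h.psi_mul_self hconj ?_ ?_ ?_
  · have := hpow n
    rw [zpow_natCast, h.phi_pow] at this
    exact_mod_cast this
  · intro k hk
    obtain ⟨a, rfl | rfl⟩ := k.even_or_odd'
    · rw [hpow] at hk
      push_cast
      exact mul_dvd_mul_left 2 (h.dvd_of_zpow a hk)
    · rw [zpow_add, hpow, zpow_one] at hk
      refine absurd ?_ (hne (-a))
      rw [zpow_neg]
      exact inv_eq_of_mul_eq_one_right hk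
  · intro k hk
    obtain ⟨a, rfl | rfl⟩ := k.even_or_odd'
    · rw [hpow] at hk
      exact h.zpow_ne_psi a hk
    · rw [zpow_add, hpow, zpow_one, hρ, (h.commute.zpow_right j).eq, ← mul_assoc, ← zpow_add,
        ← mul_assoc] at hk
      have hk1 := mul_eq_right.1 hk
      refine h.zpow_ne_tau (-(a + j)) ?_
      rw [zpow_neg]
      exact inv_eq_of_mul_eq_one_right hk1
  · rw [eq_top_iff, ← h.closure_eq_top, Subgroup.closure_le]
    have hρm : ρ ∈ Subgroup.closure {ρ, ψ} := Subgroup.subset_closure (by simp)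
    have hψm : ψ ∈ Subgroup.closure {ρ, ψ} := Subgroup.subset_closure (by simp)
    have hφm : φ ∈ Subgroup.closure {ρ, ψ} := hsq ▸ mul_mem hρm hρm
    rintro x (rfl | rfl | rfl)
    · exact hφm
    · exact hψm
    · have : x = ρ * φ ^ (-j) * ψ := by
        rw [hρ, zpow_neg, mul_inv_cancel_right, mul_assoc, h.psi_mul_self, mul_one]
      rw [this]
      exact mul_mem (mul_mem hρm (zpow_mem hφm _)) hψm

/-- With `j = -m/2` the twist `τψφ^j` is an involution; being inverted by `ψ`, it commutes with `ψ`
as well as with `φ`, and so splits off as a direct factor. -/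
theorem nonempty_mulEquiv_prod (h : YokeRelations n m φ ψ τ) (heven : Even m) :
    Nonempty (G ≃* DihedralGroup n × CyclicTwo) := by
  obtain ⟨k, hk⟩ := heven
  obtain ⟨hsq, hconj⟩ := h.twist (-k)
  have hne := h.zpow_ne_twist (-k)
  rw [show (m : ℤ) + 2 * -k = 0 by rw [hk]; push_cast; ring, zpow_zero] at hsq
  have hcφ : Commute (τ * ψ * φ ^ (-k : ℤ)) φ :=
    h.commute.mul_left ((Commute.refl φ).zpow_left _)
  set ρ := τ * ψ * φ ^ (-k : ℤ) with hρ
  have hρinv : ρ⁻¹ = ρ := inv_eq_of_mul_eq_one_right hsq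
  have hψinv : ψ⁻¹ = ψ := inv_eq_of_mul_eq_one_right h.psi_mul_self
  have hcψ : Commute ρ ψ := by
    rw [hρinv, mul_assoc] at hconj
    have := congrArg (ψ * ·) hconj
    simp only [← mul_assoc, h.psi_mul_self, one_mul] at this
    exact this
  refine DihedralGroup.nonempty_mulEquiv_prod (g := φ) (h := ψ) (t := ρ) h.phi_pow h.psi_mul_self
    h.psi_conj hsq hcφ hcψ h.dvd_of_zpow h.zpow_ne_psi hne ?_ ?_
  · intro a ha
    rw [← hcψ.eq, hρ, (h.commute.zpow_right _).eq, mul_assoc, mul_assoc τ, h.psi_mul_self,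
      mul_one] at ha
    refine h.zpow_ne_tau (a - -k) ?_
    rw [sub_eq_neg_add, zpow_add, ha, zpow_neg, inv_mul_cancel_left]
  · rw [eq_top_iff, ← h.closure_eq_top, Subgroup.closure_le]
    have hρm : ρ ∈ Subgroup.closure {φ, ψ, ρ} := Subgroup.subset_closure (by simp)
    have hψm : ψ ∈ Subgroup.closure {φ, ψ, ρ} := Subgroup.subset_closure (by simp)
    have hφm : φ ∈ Subgroup.closure {φ, ψ, ρ} := Subgroup.subset_closure (by simp)
    rintro x (rfl | rfl | rfl)
    · exact hφm
    · exact hψm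
    · have : x = ρ * φ ^ (k : ℤ) * ψ := by
        rw [hρ, zpow_neg, inv_mul_cancel_right, mul_assoc, h.psi_mul_self, mul_one]
      rw [this]
      exact mul_mem (mul_mem hρm (zpow_mem hφm _)) hψm

end YokeRelations

/-! ### The relations hold for `φ`, `ψ`, `τ` -/

namespace YokeVertex

theorem rotate_displaced {n m : ℕ} (v : YokeVertex n m) : Displaced v.rotate v (fun _ => 1) :=
  ⟨by simp [rotate], fun k hk => by simp [bit, rotate]⟩

theorem unrotate_displaced {n m : ℕ} (v : YokeVertex n m) :
    Displaced v.unrotate v (fun _ => -1) := by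
  have := v.unrotate.rotate_displaced.symm
  rwa [rotate_unrotate] at this

theorem zpow_displaced {n m : ℕ} (v : YokeVertex n m) (a : ℤ) :
    Displaced ((yokePhi n m ^ a) v) v (fun _ => a) := by
  induction a using Int.induction_on with
  | zero => exact ⟨by simp, fun k hk => by simp⟩
  | succ a ih =>
    rw [add_comm, zpow_one_add]
    exact (ih.trans (rotate_displaced _)).congr fun _ _ => by ring
  | pred a ih =>
    rw [sub_eq_neg_add, zpow_add, zpow_neg_one]
    exact (ih.trans (unrotate_displaced _)).congr fun _ _ => by ring

theorem bit_zpow {n m : ℕ} (v : YokeVertex n m) (a : ℤ) {k : ℕ} (hk : k < m) :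
    ((yokePhi n m ^ a) v).bit k = v.bit k := by
  simpa using (v.zpow_displaced a).2 k hk

theorem right_zpow {n m : ℕ} (v : YokeVertex n m) (a : ℤ) :
    ((yokePhi n m ^ a) v).right = v.right - a :=
  (v.zpow_displaced a).right_eq

theorem bit_complement {n m : ℕ} (v : YokeVertex n m) {k : ℕ} (hk : k < m) :
    v.complement.bit k = 1 - v.bit k := by
  rw [bit_of_lt _ hk, bit_of_lt _ hk]
  exact coe_one_sub _

theorem bit_reverse {n m : ℕ} (v : YokeVertex n m) {k : ℕ} (hk : k < m) :
    v.reverse.bit k = v.bit (m - 1 - k) := by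
  rw [bit_of_lt _ hk, bit_of_lt _ (by omega)]
  simp only [reverse]
  congr 3
  ext
  simp only [Fin.val_rev]
  omega

theorem reverse_zeroVertex {n m : ℕ} (r : ZMod n) :
    (zeroVertex m r).reverse = zeroVertex m (-r) := by
  ext <;> simp [reverse, zeroVertex]

theorem zpow_zeroVertex {n m : ℕ} (r : ZMod n) (a : ℤ) :
    (yokePhi n m ^ a) (zeroVertex m r) = zeroVertex m (r - (a : ZMod n)) := by
  rw [eq_zeroVertex (v := (yokePhi n m ^ a) (zeroVertex m r))
    fun k hk => by rw [bit_zpow _ _ hk, bit_zeroVertex], right_zpow]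
  rfl

/-- The vertex `(-1, 1, 0, …, 0)`. -/
theorem exists_step_zero {n m : ℕ} (hm : 1 ≤ m) : ∃ w : YokeVertex n m,
    (zeroVertex m 0).Step 0 w ∧ w.left = -1 ∧ w.right = 0 ∧ w.bit 0 = 1 ∧
      ∀ k, 0 < k → k < m → w.bit k = 0 := by
  obtain ⟨w, hw⟩ := (exists_step_iff hm (zeroVertex m (0 : ZMod n)) 0).2 ⟨by omega, by omega⟩
  refine ⟨w, hw, ?_⟩
  obtain ⟨-, ε, hε, h⟩ := hw
  have hs := (Step.sign (by omega) hε h).2 (by omega)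
  rw [bit_zeroVertex] at hs
  subst hs
  refine ⟨by rw [h.1]; simp [zeroVertex], by rw [h.right_eq, if_neg (by omega)]; simp [zeroVertex],
    by rw [h.2 0 (by omega), bit_zeroVertex]; simp, fun k h0 hk => ?_⟩
  rw [h.2 k hk, bit_zeroVertex]
  simp
  omega

end YokeVertex

open YokeVertex

theorem yokePhi_mem (n m : ℕ) : yokePhi n m ∈ yokeFundamental n m :=
  Subgroup.subset_closure (by simp)

theorem yokePsi_mem (n m : ℕ) : yokePsi n m ∈ yokeFundamental n m :=
  Subgroup.subset_closure (by simp)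

theorem yokeTau_mem (n m : ℕ) : yokeTau n m ∈ yokeFundamental n m :=
  Subgroup.subset_closure (by simp)

theorem yokePhi_pow (n m : ℕ) : yokePhi n m ^ n = 1 := by
  ext1 v
  have h := v.zpow_displaced (n : ℤ)
  rw [zpow_natCast] at h
  exact h.unique ⟨by simp, fun k hk => by simp⟩

theorem dvd_of_yokePhi_zpow {n m : ℕ} {k : ℤ} (h : yokePhi n m ^ k = 1) : (n : ℤ) ∣ k := by
  have hd := (zeroVertex m (0 : ZMod n)).zpow_displaced k
  rw [h] at hd
  exact (ZMod.intCast_zmod_eq_zero_iff_dvd _ _).1 hd.cast_eq_zero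

theorem yokePsi_mul_self (n m : ℕ) : yokePsi n m * yokePsi n m = 1 := by
  ext1 v
  exact reverse_reverse v

theorem yokeTau_mul_self (n m : ℕ) : yokeTau n m * yokeTau n m = 1 := by
  ext1 v
  exact complement_complement v

theorem yokePsi_conj (n m : ℕ) : yokePsi n m * yokePhi n m * yokePsi n m = (yokePhi n m)⁻¹ := by
  ext1 v
  change v.reverse.rotate.reverse = v.unrotate
  ext <;> simp [reverse, rotate, unrotate]

theorem yokeTau_conj (n m : ℕ) : yokeTau n m * yokePhi n m * yokeTau n m = (yokePhi n m)⁻¹ := by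
  ext1 v
  change v.complement.rotate.complement = v.unrotate
  ext
  · simp [complement, rotate, unrotate]
    ring
  · simp [complement, rotate, unrotate]
  · simp [complement, rotate, unrotate]
    ring

theorem yokePsi_mul_yokeTau (n m : ℕ) :
    yokePsi n m * yokeTau n m = yokePhi n m ^ (-m : ℤ) * (yokeTau n m * yokePsi n m) := by
  ext1 v
  refine Displaced.unique (v := v.reverse.complement) (D := fun _ => -(m : ℤ)) ?_
    (zpow_displaced _ _)
  change Displaced v.complement.reverse v.reverse.complement _
  refine ⟨?_, fun k hk => ?_⟩
  · simp [complement, reverse]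
  · rw [bit_reverse _ hk, bit_complement _ (by omega), bit_complement _ hk, bit_reverse _ hk]
    ring

theorem yokeRelations {n m : ℕ} (hnm : 1 < n ∧ 1 ≤ m ∨ 2 ≤ m) (htop : yokeFundamental n m = ⊤) :
    YokeRelations n m (yokePhi n m) (yokePsi n m) (yokeTau n m) where
  phi_pow := yokePhi_pow n m
  psi_mul_self := yokePsi_mul_self n m
  tau_mul_self := yokeTau_mul_self n m
  psi_conj := yokePsi_conj n m
  tau_conj := yokeTau_conj n m
  psi_mul_tau := yokePsi_mul_yokeTau n m
  dvd_of_zpow _ h := dvd_of_yokePhi_zpow h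
  zpow_ne_psi k h := by
    -- Powers of `φ` keep the middle entries, whereas `ψ` moves the 1 in `(-1, 1, 0, …, 0)` if `m ≥
    -- 2`. If `m = 1`, the fixed vertex `(0, 0, 0)` forces `k ≡ 0`, and then the buckets of `(-1, 1,
    -- 0)` give `-1 = 0` in `ℤ/n` with `n > 1`.
    obtain ⟨w, -, hl, hr, h0, hk⟩ := exists_step_zero (n := n) (m := m) (by omega)
    have hw : (yokePhi n m ^ k) w = w.reverse := by rw [h]; rfl
    by_cases hm : 2 ≤ m
    · have h1 := bit_zpow w k (show 0 < m by omega)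
      rw [hw, bit_reverse _ (by omega), hk _ (by omega) (by omega), h0] at h1
      omega
    · have hz : (yokePhi n m ^ k) (zeroVertex m 0) = (zeroVertex m 0).reverse := by rw [h]; rfl
      have h1 := (w.zpow_displaced k).1
      have h2 := ((zeroVertex m (0 : ZMod n)).zpow_displaced k).1
      rw [hw] at h1
      rw [hz, reverse_zeroVertex] at h2
      have : Fact (1 < n) := ⟨by omega⟩
      simp only [reverse, hl, hr] at h1
      simp [zeroVertex] at h2
      rw [← h2] at h1
      simp at h1
  zpow_ne_tau k h := by
    have h1 := bit_zpow (zeroVertex m (0 : ZMod n)) k (show 0 < m by omega)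
    rw [h] at h1
    change (zeroVertex m (0 : ZMod n)).complement.bit 0 = _ at h1
    rw [bit_complement _ (by omega), bit_zeroVertex] at h1
    omega
  zpow_ne_tau_mul_psi k h := by
    have h1 := bit_zpow (zeroVertex m (0 : ZMod n)) k (show 0 < m by omega)
    rw [h] at h1
    change (zeroVertex m (0 : ZMod n)).reverse.complement.bit 0 = _ at h1
    rw [bit_complement _ (by omega), reverse_zeroVertex, bit_zeroVertex, bit_zeroVertex] at h1
    omega
  closure_eq_top := htop

/-! ### Generation of the automorphism group -/

namespace YokeVertex

theorem setOf_avail_zeroVertex {n m : ℕ} (r : ZMod n) :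
    {i | (zeroVertex m r).Avail i} = {0, m} := by
  ext i
  simp [Avail, bit_zeroVertex]
  omega

/-- The middle entries of the image of a degree two vertex are equal. -/
theorem bit_apply_zeroVertex {n m : ℕ} (hm : 1 ≤ m) (hm2 : m ≠ 2) (f : YokeAut n m) (r : ZMod n)
    {k : ℕ} (hk : k < m) : (f (zeroVertex m r)).bit k = (f (zeroVertex m r)).bit 0 := by
  by_cases hm1 : m = 1
  · rw [show k = 0 by omega]
  have hcard := ncard_neighborSet_apply f (zeroVertex m r)
  rw [ncard_neighborSet (by omega), ncard_neighborSet (by omega), setOf_avail_zeroVertex] at hcard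
  -- The labels 0 and `m` are always available, so degree two leaves no inner label and the middle
  -- entries never change.
  have hset := Set.eq_of_subset_of_ncard_le (s := {0, m}) (t := {i | (f (zeroVertex m r)).Avail i})
    (by
      rintro i (rfl | rfl)
      · exact ⟨by omega, by omega⟩
      · exact ⟨le_rfl, by omega⟩) hcard.le (finite_avail _)
  induction k with
  | zero => rfl
  | succ k ih =>
    rw [← ih (by omega)]
    by_contra hne
    have : k + 1 ∈ {i | (f (zeroVertex m r)).Avail i} := ⟨by omega, fun _ _ => Ne.symm hne⟩
    rw [← hset] at this
    simp at this
    omega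

theorem exists_fundamental_apply_zeroVertex {n m : ℕ} (hm2 : m ≠ 2) (f : YokeAut n m) :
    ∃ g ∈ yokeFundamental n m, (g * f) (zeroVertex m 0) = zeroVertex m 0 := by
  have key : ∀ f : YokeAut n m, (∀ k < m, (f (zeroVertex m 0)).bit k = 0) →
      ∃ g ∈ yokeFundamental n m, (g * f) (zeroVertex m 0) = zeroVertex m 0 := by
    intro f hf
    obtain ⟨a, ha⟩ := ZMod.intCast_surjective (f (zeroVertex m 0)).right
    refine ⟨yokePhi n m ^ a, zpow_mem (yokePhi_mem n m) _, ?_⟩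
    rw [RelIso.mul_apply, eq_zeroVertex hf, zpow_zeroVertex, ha, sub_self]
  by_cases h0 : ∀ k < m, (f (zeroVertex m 0)).bit k = 0
  · exact key f h0
  push Not at h0
  obtain ⟨l, hl, hl0⟩ := h0
  obtain ⟨g, hg, h⟩ := key (yokeTau n m * f) fun k hk => by
    change (f (zeroVertex m 0)).complement.bit k = 0
    rw [bit_apply_zeroVertex (by omega) hm2 f _ hl] at hl0
    rw [bit_complement _ hk, bit_apply_zeroVertex (by omega) hm2 f _ hk]
    have := (f (zeroVertex m 0)).bit_eq_zero_or_one 0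
    omega
  exact ⟨g * yokeTau n m, mul_mem hg (yokeTau_mem n m), h⟩

end YokeVertex

/-- After correction by `⟨φ, ψ, τ⟩` the vertex `(0, …, 0)` is fixed. Its neighbours are `w` and
`w.reverse`, so a possible further factor `ψ` makes the whole star fixed, and rigidity applies. -/
theorem yokeFundamental_eq_top_of_pos {n m : ℕ} (hn : 1 ≤ n) (hm : 1 ≤ m)
    (hnm : m = 1 ∨ 3 ≤ m ∧ 4 < n * (m + 1)) : yokeFundamental n m = ⊤ := by
  rw [eq_top_iff]
  intro f _
  obtain ⟨g, hg, hgf⟩ := exists_fundamental_apply_zeroVertex (by omega) f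
  obtain ⟨w, hw, -⟩ := exists_step_zero (n := n) hm
  have hw' : (zeroVertex m (0 : ZMod n)).Step m w.reverse := by
    have := hw.reverse
    rwa [reverse_zeroVertex, neg_zero] at this
  have hadj : ∀ u, (yokeGraph n m).Adj (zeroVertex m 0) u ↔ u = w ∨ u = w.reverse := by
    intro u
    rw [adj_iff_step hm]
    constructor
    · rintro ⟨i, hi⟩
      have := (exists_step_iff hm _ i).1 ⟨u, hi⟩
      have : i ∈ {i | (zeroVertex m (0 : ZMod n)).Avail i} := this
      rw [setOf_avail_zeroVertex] at this
      rcases this with rfl | rfl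
      · exact Or.inl (hi.unique hm hw)
      · exact Or.inr (hi.unique hm hw')
    · rintro (rfl | rfl)
      · exact ⟨_, hw⟩
      · exact ⟨_, hw'⟩
  have key : ∀ h : YokeAut n m, h (zeroVertex m 0) = zeroVertex m 0 → h w = w → h = 1 := by
    intro h h0 hhw
    refine eq_one_of_fixesStar hn hm hnm ⟨h0, fun u hu => ?_⟩
    rcases (hadj u).1 hu with rfl | rfl
    · exact hhw
    · have := h.map_adj_iff.2 hu
      rw [h0] at this
      rcases (hadj _).1 this with h1 | h1
      · rw [h.injective (h1.trans hhw.symm)]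
        exact hhw
      · exact h1
  have hgfw := (g * f).map_adj_iff.2 ((hadj w).2 (Or.inl rfl))
  rw [hgf] at hgfw
  rcases (hadj _).1 hgfw with h1 | h1
  · have h2 := key _ hgf h1
    rw [eq_inv_of_mul_eq_one_right h2]
    exact inv_mem hg
  · have h2 := key (yokePsi n m * (g * f)) (by
      rw [RelIso.mul_apply, hgf]
      change (zeroVertex m (0 : ZMod n)).reverse = _
      rw [reverse_zeroVertex, neg_zero]) (by
      rw [RelIso.mul_apply, h1]
      exact reverse_reverse w)
    rw [← mul_assoc] at h2
    rw [eq_inv_of_mul_eq_one_right h2]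
    exact inv_mem (mul_mem (yokePsi_mem n m) hg)

theorem adj_zeroVertex_zero_iff {n : ℕ} {u : YokeVertex n 0} {r : ZMod n} :
    (yokeGraph n 0).Adj (zeroVertex 0 r) u ↔
      r ≠ u.right ∧ (u.right = r + 1 ∨ u.right = r - 1) := by
  have hstep : ∀ ε : ℤ, Displaced u (zeroVertex 0 r) (fun k => if k = 0 then ε else 0) ↔
      u.right = r - ε := by
    intro ε
    constructor
    · intro h
      rw [h.right_eq]
      simp [zeroVertex]
    · intro h
      rw [eq_zeroVertex (v := u) (by omega), h]
      exact ⟨by simp [zeroVertex]; ring, by omega⟩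
  have hne : zeroVertex 0 r ≠ u ↔ r ≠ u.right := by
    rw [eq_zeroVertex (v := u) (by omega), not_iff_not]
    exact ⟨fun h => congrArg YokeVertex.right h, fun h => congrArg _ h⟩
  change _ ∧ _ ↔ _
  rw [hne]
  refine and_congr_right fun _ => ?_
  constructor
  · rintro ⟨i, hi, h⟩
    obtain ⟨-, ε, rfl | rfl, h⟩ := step_iff_shift.2 ⟨hi, h.symm⟩
    · obtain rfl : i = 0 := by omega
      have := (hstep _).1 h
      right
      simpa using this
    · obtain rfl : i = 0 := by omega
      have := (hstep _).1 h
      left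
      simpa using this
  · rintro (h | h)
    · exact ⟨0, le_rfl, (step_iff_shift.1 ⟨le_rfl, -1, Or.inr rfl,
        (hstep _).2 (by rw [h]; push_cast; ring)⟩).2.symm⟩
    · exact ⟨0, le_rfl, (step_iff_shift.1 ⟨le_rfl, 1, Or.inl rfl,
        (hstep _).2 (by rw [h]; push_cast; ring)⟩).2.symm⟩

/-- The right entry identifies the graph with the cycle on `ℤ/n`, degenerate for `n ≤ 2`. An
automorphism fixing two consecutive vertices is trivial, as seen by walking around the cycle. -/
theorem yokeFundamental_eq_top_of_zero {n : ℕ} (hn : 1 ≤ n) : yokeFundamental n 0 = ⊤ := by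
  rw [eq_top_iff]
  intro f _
  obtain ⟨g, hg, hgf⟩ := exists_fundamental_apply_zeroVertex (by omega) f
  have : NeZero n := ⟨by omega⟩
  have hext : ∀ {u v : YokeVertex n 0}, u.right = v.right → u = v := by
    intro u v h
    rw [eq_zeroVertex (v := u) (by omega), eq_zeroVertex (v := v) (by omega), h]
  have hsucc : ∀ (h : YokeAut n 0) (r : ZMod n), h (zeroVertex 0 r) = zeroVertex 0 r →
      h (zeroVertex 0 (r + 1)) = zeroVertex 0 (r + 1) ∨
        h (zeroVertex 0 (r + 1)) = zeroVertex 0 (r - 1) := by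
    intro h r hr
    by_cases hn1 : r = r + 1
    · left
      rw [← hn1, hr]
    · have hadj : (yokeGraph n 0).Adj (zeroVertex 0 r) (zeroVertex 0 (r + 1)) :=
        adj_zeroVertex_zero_iff.2 ⟨hn1, Or.inl rfl⟩
      have := h.map_adj_iff.2 hadj
      rw [hr] at this
      exact (adj_zeroVertex_zero_iff.1 this).2.imp hext hext
  have key : ∀ h : YokeAut n 0, h (zeroVertex 0 0) = zeroVertex 0 0 →
      h (zeroVertex 0 1) = zeroVertex 0 1 → h = 1 := by
    intro h h0 h1
    have hall : ∀ k : ℕ, h (zeroVertex 0 (k : ZMod n)) = zeroVertex 0 (k : ZMod n) ∧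
        h (zeroVertex 0 (k + 1 : ZMod n)) = zeroVertex 0 (k + 1 : ZMod n) := by
      intro k
      induction k with
      | zero => simpa using ⟨h0, h1⟩
      | succ k ih =>
        push_cast
        refine ⟨ih.2, ?_⟩
        rcases hsucc h _ ih.2 with h2 | h2
        · exact h2
        · rw [add_sub_cancel_right] at h2
          have h3 := h.injective (h2.trans ih.1.symm)
          rw [h2, h3]
    ext1 v
    have := (hall v.right.val).1
    rw [ZMod.natCast_zmod_val] at this
    rw [eq_zeroVertex (v := v) (by omega)]
    exact this
  rcases hsucc (g * f) 0 hgf with h1 | h1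
  · have h2 := key _ hgf (by simpa using h1)
    rw [eq_inv_of_mul_eq_one_right h2]
    exact inv_mem hg
  · have h2 := key (yokePsi n 0 * (g * f)) (by
      rw [RelIso.mul_apply, hgf]
      change (zeroVertex 0 (0 : ZMod n)).reverse = _
      rw [reverse_zeroVertex, neg_zero]) (by
      rw [zero_add, zero_sub] at h1
      rw [RelIso.mul_apply, h1]
      change (zeroVertex 0 (-1 : ZMod n)).reverse = _
      rw [reverse_zeroVertex, neg_neg])
    rw [← mul_assoc] at h2
    rw [eq_inv_of_mul_eq_one_right h2]
    exact inv_mem (mul_mem (yokePsi_mem n 0) hg)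

theorem yokeFundamental_eq_top {n m : ℕ} (hn : 1 ≤ n) (hm : m ≠ 2) (hnm : (n, m) ≠ (1, 3)) :
    yokeFundamental n m = ⊤ := by
  by_cases h0 : m = 0
  · subst h0
    exact yokeFundamental_eq_top_of_zero hn
  · refine yokeFundamental_eq_top_of_pos hn (by omega) ?_
    by_cases h1 : m = 1
    · exact Or.inl h1
    · refine Or.inr ⟨by omega, ?_⟩
      by_cases h3 : m = 3
      · subst h3
        have : n ≠ 1 := fun h => hnm (by rw [h])
        omega
      · nlinarith [show 4 ≤ m by omega]

/-! ### The exceptional graph `Y_{1,3}` -/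

namespace YokeOneThree

/-- The words `100, 001, 110, 011, 000, 111, 010, 101`. -/
def word : Fin 8 → Fin 3 → Fin 2 :=
  ![![1, 0, 0], ![0, 0, 1], ![1, 1, 0], ![0, 1, 1], ![0, 0, 0], ![1, 1, 1], ![0, 1, 0],
    ![1, 0, 1]]

/-- The neighbours of the vertices of `Y_{1,3}`, numbered as in `word`. -/
def nbrs : Fin 8 → Finset (Fin 8) :=
  ![{4, 6, 7}, {4, 6, 7}, {5, 6, 7}, {5, 6, 7}, {0, 1}, {2, 3}, {0, 1, 2, 3}, {0, 1, 2, 3}]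

/-- A copy of `Y_{1,3}` on eight numbered vertices. -/
def graph : SimpleGraph (Fin 8) where
  Adj a b := b ∈ nbrs a
  symm := ⟨by decide⟩
  loopless := ⟨by decide⟩

instance : DecidableRel graph.Adj := fun a b => inferInstanceAs (Decidable (b ∈ nbrs a))

/-- The vertex of `Y_{1,3}` with a given word. -/
def vertex (a : Fin 8) : YokeVertex 1 3 := ⟨0, word a, 0, Subsingleton.elim _ _⟩

theorem vertex_bijective : Function.Bijective vertex := by
  have hinj : Function.Injective word := by decide
  have hsurj : ∀ w : Fin 3 → Fin 2, ∃ a, word a = w := by decide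
  refine ⟨fun a b h => hinj (congrArg YokeVertex.mid h), fun v => ?_⟩
  obtain ⟨a, ha⟩ := hsurj v.mid
  exact ⟨a, YokeVertex.ext (Subsingleton.elim _ _) ha (Subsingleton.elim _ _)⟩

instance {n m : ℕ} (u v : YokeVertex n m) (j : ℕ) (d : ℤ) : Decidable (u.EntryEq v j d) := by
  unfold YokeVertex.EntryEq
  infer_instance

instance {n m : ℕ} (u v : YokeVertex n m) (i : ℕ) : Decidable (u.Shift v i) := by
  unfold YokeVertex.Shift
  infer_instance

theorem adj_vertex_iff (a b : Fin 8) :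
    (yokeGraph 1 3).Adj (vertex a) (vertex b) ↔ graph.Adj a b := by
  have h : ∀ a b : Fin 8, (a ≠ b ∧ ∃ i < 4, (vertex a).Shift (vertex b) i) ↔ graph.Adj a b := by
    decide
  rw [← h]
  change (_ ≠ _ ∧ _) ↔ _
  rw [vertex_bijective.1.ne_iff]
  simp only [Nat.lt_succ_iff]

/-- The numbering of the vertices is an isomorphism of graphs. -/
noncomputable def vertexIso : graph ≃g yokeGraph 1 3 where
  toEquiv := Equiv.ofBijective vertex vertex_bijective
  map_rel_iff' := adj_vertex_iff _ _

/-- The induced isomorphism of automorphism groups. -/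
noncomputable def autEquiv : YokeAut 1 3 ≃* (graph ≃g graph) where
  toFun f := (vertexIso.trans f).trans vertexIso.symm
  invFun f := (vertexIso.symm.trans f).trans vertexIso
  left_inv f := by ext1 v; simp
  right_inv f := by ext1 v; simp
  map_mul' f g := by ext1 v; simp

/-- An automorphism from a map and its inverse. -/
def mkAut (f g : Fin 8 → Fin 8) (hgf : ∀ v, g (f v) = v) (hfg : ∀ v, f (g v) = v)
    (h : ∀ a b, graph.Adj (f a) (f b) ↔ graph.Adj a b) : graph ≃g graph :=
  ⟨⟨f, g, hgf, hfg⟩, h _ _⟩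

/-- The rotation of order four. -/
def rot : graph ≃g graph :=
  mkAut ![2, 3, 1, 0, 5, 4, 6, 7] ![3, 2, 0, 1, 5, 4, 6, 7] (by decide) (by decide) (by decide)

/-- The reflection. -/
def refl : graph ≃g graph :=
  mkAut ![1, 0, 2, 3, 4, 5, 6, 7] ![1, 0, 2, 3, 4, 5, 6, 7] (by decide) (by decide) (by decide)

/-- The central involution. -/
def swap : graph ≃g graph :=
  mkAut ![0, 1, 2, 3, 4, 5, 7, 6] ![0, 1, 2, 3, 4, 5, 7, 6] (by decide) (by decide) (by decide)

theorem ext_fin {f g : graph ≃g graph} (h : ∀ a, f a = g a) : f = g := by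
  ext1 a
  exact h a

theorem rot_pow : rot ^ 4 = 1 := by
  change rot ^ (3 + 1) = 1
  simp only [pow_succ, pow_zero, one_mul]
  exact ext_fin (by decide)

theorem rot_zpow (k : ℤ) :
    ((4 : ℕ) : ℤ) ∣ k ∧ rot ^ k = 1 ∨ rot ^ k = rot ∨ rot ^ k = rot * rot ∨
      rot ^ k = rot * rot * rot := by
  have h := zpow_eq_zpow_emod' k rot_pow
  have h4 : k % (4 : ℕ) = 0 ∨ k % (4 : ℕ) = 1 ∨ k % (4 : ℕ) = 2 ∨ k % (4 : ℕ) = 3 := by omega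
  rcases h4 with h4 | h4 | h4 | h4 <;> rw [h4] at h
  · exact Or.inl ⟨Int.dvd_of_emod_eq_zero h4, h⟩
  · exact Or.inr (Or.inl (by rw [h, zpow_one]))
  · exact Or.inr (Or.inr (Or.inl (by rw [h]; rfl)))
  · exact Or.inr (Or.inr (Or.inr (by rw [h]; rfl)))

theorem ne_of_apply_ne {f g : graph ≃g graph} (a : Fin 8) (h : f a ≠ g a) : f ≠ g :=
  fun e => h (by rw [e])

theorem eq_one_of_fix {f : graph ≃g graph} (h0 : f 0 = 0) (h2 : f 2 = 2) (h6 : f 6 = 6) :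
    f = 1 := by
  have hadj : ∀ a b, graph.Adj (f a) (f b) ↔ graph.Adj a b := fun a b => f.map_adj_iff
  have hne : ∀ a b, a ≠ b → f a ≠ f b := fun a b => f.injective.ne
  have h4 : f 4 = 4 := by
    have a1 := hadj 4 0
    have a2 := hadj 4 2
    rw [h0] at a1
    rw [h2] at a2
    generalize f 4 = y at *
    revert y
    decide
  have h5 : f 5 = 5 := by
    have a1 := hadj 5 0
    have a2 := hadj 5 2
    rw [h0] at a1
    rw [h2] at a2
    generalize f 5 = y at *
    revert y
    decide
  have h7 : f 7 = 7 := by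
    have a1 := hadj 7 0
    have a2 := hadj 7 2
    have a3 := hne 7 6 (by decide)
    rw [h0] at a1
    rw [h2] at a2
    rw [h6] at a3
    generalize f 7 = y at *
    revert y
    decide
  have h1 : f 1 = 1 := by
    have a1 := hadj 1 4
    have a2 := hne 1 0 (by decide)
    rw [h4] at a1
    rw [h0] at a2
    generalize f 1 = y at *
    revert y
    decide
  have h3 : f 3 = 3 := by
    have a1 := hadj 3 5
    have a2 := hne 3 2 (by decide)
    rw [h5] at a1
    rw [h2] at a2
    generalize f 3 = y at *
    revert y
    decide
  refine ext_fin fun a => ?_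
  fin_cases a
  exacts [h0, h1, h2, h3, h4, h5, h6, h7]

theorem closure_eq_top : Subgroup.closure {rot, refl, swap} = ⊤ := by
  rw [eq_top_iff]
  intro f _
  have hadj : ∀ a b, graph.Adj (f a) (f b) ↔ graph.Adj a b := fun a b => f.map_adj_iff
  -- The images of 0, 2, 6 determine `f`. Using the images of 4 and 5 as witnesses, adjacency leaves
  -- 16 triples: `a` and `b` from opposite twin pairs `{0, 1}`, `{2, 3}`, and `c` in `{6, 7}`. The
  -- products `rot^i refl^j swap^k` realize them all.
  have key : ∀ a d, graph.Adj d a → ∀ b, ¬ graph.Adj d b → ∀ e, graph.Adj e b →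
      ¬ graph.Adj e a → ∀ c, graph.Adj c a → graph.Adj c b →
      ∃ i : Fin 4, ∃ j k : Fin 2, (rot^[i] (refl^[j] (swap^[k] 0))) = a ∧
        (rot^[i] (refl^[j] (swap^[k] 2))) = b ∧ (rot^[i] (refl^[j] (swap^[k] 6))) = c := by
    decide
  obtain ⟨i, j, k, h0, h2, h6⟩ := key (f 0) (f 4) ((hadj _ _).2 (by decide)) (f 2)
    (fun h => absurd ((hadj _ _).1 h) (by decide)) (f 5) ((hadj _ _).2 (by decide))
    (fun h => absurd ((hadj _ _).1 h) (by decide)) (f 6) ((hadj _ _).2 (by decide))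
    ((hadj _ _).2 (by decide))
  have hpow : ∀ (g : graph ≃g graph) (l : ℕ) (a : Fin 8), g^[l] a = (g ^ l) a := by
    intro g l
    induction l with
    | zero => exact fun a => rfl
    | succ l ih =>
      intro a
      rw [Function.iterate_succ_apply', ih, pow_succ']
      rfl
  simp only [hpow] at h0 h2 h6
  have h1 : (rot ^ (i : ℕ) * refl ^ (j : ℕ) * swap ^ (k : ℕ))⁻¹ * f = 1 := by
    have happ : ∀ a, (rot ^ (i : ℕ)) ((refl ^ (j : ℕ)) ((swap ^ (k : ℕ)) a)) = f a →
        ((rot ^ (i : ℕ) * refl ^ (j : ℕ) * swap ^ (k : ℕ))⁻¹ * f) a = a := by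
      intro a h
      rw [RelIso.mul_apply, ← h]
      exact RelIso.inv_apply_self _ a
    exact eq_one_of_fix (happ 0 h0) (happ 2 h2) (happ 6 h6)
  rw [← inv_mul_eq_one.1 h1]
  exact mul_mem (mul_mem (pow_mem (Subgroup.subset_closure (by simp)) _)
    (pow_mem (Subgroup.subset_closure (by simp)) _))
    (pow_mem (Subgroup.subset_closure (by simp)) _)

theorem nonempty_mulEquiv : Nonempty (YokeAut 1 3 ≃* DihedralGroup 4 × CyclicTwo) := by
  have h : Nonempty ((graph ≃g graph) ≃* DihedralGroup 4 × CyclicTwo) := by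
    refine DihedralGroup.nonempty_mulEquiv_prod (g := rot) (h := refl) (t := swap) rot_pow
      (ext_fin (by decide)) (ext_fin (by decide)) (ext_fin (by decide)) (ext_fin (by decide))
      (ext_fin (by decide)) ?_ ?_ ?_ ?_ closure_eq_top
    · intro k hk
      rcases rot_zpow k with h | h | h | h
      · exact h.1
      all_goals
        rw [h] at hk
        exact absurd hk (ne_of_apply_ne 0 (by decide))
    · intro k
      rcases rot_zpow k with ⟨-, h⟩ | h | h | h <;> rw [h] <;>
        -- The square of `rot` agrees with `refl` at 0, so that case is separated at 2.
        first | exact ne_of_apply_ne 0 (by decide) | exact ne_of_apply_ne 2 (by decide)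
    · intro k
      rcases rot_zpow k with ⟨-, h⟩ | h | h | h <;> rw [h] <;>
        exact ne_of_apply_ne 6 (by decide)
    · intro k
      rcases rot_zpow k with ⟨-, h⟩ | h | h | h <;> rw [h] <;>
        exact ne_of_apply_ne 6 (by decide)
  exact h.map autEquiv.trans

end YokeOneThree

/-! ### Small cases and conclusion -/

theorem Subgroup.eq_one_or_of_closure {G : Type*} [Group G] {S : Set G} {t : G}
    (ht : t * t = 1) (hS : ∀ x ∈ S, x = 1 ∨ x = t) (htop : Subgroup.closure S = ⊤) (x : G) :
    x = 1 ∨ x = t := by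
  have hx : x ∈ Subgroup.closure S := htop ▸ Subgroup.mem_top x
  induction hx using Subgroup.closure_induction with
  | mem x hx => exact hS x hx
  | one => exact Or.inl rfl
  | mul x y _ _ hx hy => rcases hx with rfl | rfl <;> rcases hy with rfl | rfl <;> simp [ht]
  | inv x _ hx =>
    rcases hx with rfl | rfl
    · simp
    · exact Or.inr (inv_eq_of_mul_eq_one_right ht)

theorem dihedralGroup_two_mulEquiv :
    Nonempty (DihedralGroup 2 ≃* CyclicTwo × CyclicTwo) := by
  have : IsKleinFour (CyclicTwo × CyclicTwo) :=
    ⟨by simp, by rw [Monoid.exponent_prod]; simp⟩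
  exact IsKleinFour.nonempty_mulEquiv

open YokeVertex

theorem nonempty_yokeAut_two_zero : Nonempty (YokeAut 2 0 ≃* CyclicTwo) := by
  have hext : ∀ {u v : YokeVertex 2 0}, u.left = v.left → u = v := fun h => ext_bit h (by omega)
  have hright : ∀ v : YokeVertex 2 0, v.right = v.left := by
    intro v
    have := v.sum_bit
    simp only [Finset.range_zero, Finset.sum_empty, add_zero] at this
    generalize v.left = a at *
    generalize v.right = b at *
    revert a b
    decide
  refine CyclicTwo.nonempty_mulEquiv (t := yokePhi 2 0) ?_ (Subgroup.eq_one_or_of_closure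
    (by rw [← pow_two, yokePhi_pow]) ?_ (yokeFundamental_eq_top (by omega) (by omega) (by simp)))
  · intro h
    have := dvd_of_yokePhi_zpow (n := 2) (m := 0) (k := 1) (by rw [zpow_one, h])
    omega
  · rintro x (rfl | rfl | rfl)
    · exact Or.inr rfl
    · left
      ext1 v
      exact hext (hright v)
    · left
      ext1 v
      refine hext ?_
      change -v.left = v.left
      generalize v.left = a
      revert a
      decide

theorem nonempty_yokeAut_one_one : Nonempty (YokeAut 1 1 ≃* CyclicTwo) := by
  refine CyclicTwo.nonempty_mulEquiv (t := yokeTau 1 1) ?_ (Subgroup.eq_one_or_of_closure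
    (yokeTau_mul_self 1 1) ?_ (yokeFundamental_eq_top (by omega) (by omega) (by simp)))
  · intro h
    have h1 : (zeroVertex 1 (0 : ZMod 1)).complement = zeroVertex 1 0 :=
      DFunLike.congr_fun h (zeroVertex 1 0)
    have h2 := bit_complement (zeroVertex 1 (0 : ZMod 1)) (k := 0) (by omega)
    rw [h1, bit_zeroVertex] at h2
    omega
  · rintro x (rfl | rfl | rfl)
    · left
      simpa using yokePhi_pow 1 1
    · left
      ext1 v
      refine ext_bit (Subsingleton.elim _ _) fun k hk => ?_
      change v.reverse.bit k = v.bit k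
      rw [bit_reverse v hk, show 1 - 1 - k = k by omega]
    · exact Or.inr rfl

theorem nonempty_yokeAut_zero {n : ℕ} (hn : 2 < n) :
    Nonempty (YokeAut n 0 ≃* DihedralGroup n) := by
  -- Without middle entries the two buckets are opposite, so negating and exchanging them coincide.
  have hτ : yokeTau n 0 = yokePsi n 0 := by
    ext1 v
    refine ext_bit ?_ (by omega)
    change -v.left = v.right
    have := v.sum_bit
    simp only [Finset.range_zero, Finset.sum_empty, add_zero] at this
    linear_combination -this
  refine DihedralGroup.nonempty_mulEquiv (yokePhi_pow n 0) (yokePsi_mul_self n 0)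
    (yokePsi_conj n 0) (fun k => dvd_of_yokePhi_zpow) ?_ ?_
  · intro k hk
    have key : ∀ r : ZMod n, r - k = -r := by
      intro r
      have := congrArg YokeVertex.right (zpow_zeroVertex (m := 0) r k)
      rw [hk] at this
      change (zeroVertex 0 r).reverse.right = _ at this
      rw [reverse_zeroVertex] at this
      exact this.symm
    have h0 := key 0
    have h1 := key 1
    have h2 : ((2 : ℕ) : ZMod n) = 0 := by
      push_cast
      linear_combination h1 - h0
    rw [ZMod.natCast_eq_zero_iff] at h2
    have := Nat.le_of_dvd (by omega) h2
    omega
  · have := yokeFundamental_eq_top (n := n) (m := 0) (by omega) (by omega) (by simp)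
    rw [yokeFundamental, hτ] at this
    simpa using this

theorem mainTheorem6 :
    Nonempty (YokeAut 1 3 ≃* DihedralGroup 4 × CyclicTwo) ∧
    ∀ n m : ℕ, 1 ≤ n → m ≠ 2 → (n, m) ≠ (1, 3) →
      yokeFundamental n m = ⊤ ∧
      (n = 1 → m = 0 → Nonempty (YokeAut n m ≃* Unit)) ∧
      (n = 2 → m = 0 → Nonempty (YokeAut n m ≃* CyclicTwo)) ∧
      (n = 1 → m = 1 → Nonempty (YokeAut n m ≃* CyclicTwo)) ∧
      (2 < n → m = 0 → Nonempty (YokeAut n m ≃* DihedralGroup n)) ∧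
      (n = 1 → 1 < m → Nonempty (YokeAut n m ≃* CyclicTwo × CyclicTwo)) ∧
      (1 < n → 0 < m → (Odd n ∨ Odd m) →
        Nonempty (YokeAut n m ≃* DihedralGroup (2 * n))) ∧
      (1 < n → 0 < m → Even n → Even m →
        Nonempty (YokeAut n m ≃* DihedralGroup n × CyclicTwo)) := by
  refine ⟨YokeOneThree.nonempty_mulEquiv, fun n m hn hm hnm => ?_⟩
  have htop := yokeFundamental_eq_top hn hm hnm
  refine ⟨htop, ?_, ?_, ?_, ?_, ?_, ?_, ?_⟩
  · rintro rfl rfl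
    have : Subsingleton (YokeVertex 1 0) :=
      ⟨fun u v => ext_bit (Subsingleton.elim _ _) (by omega)⟩
    have : Unique (YokeAut 1 0) := ⟨⟨1⟩, fun f => RelIso.ext fun v => Subsingleton.elim _ _⟩
    exact ⟨MulEquiv.ofUnique⟩
  · rintro rfl rfl
    exact nonempty_yokeAut_two_zero
  · rintro rfl rfl
    exact nonempty_yokeAut_one_one
  · rintro h rfl
    exact nonempty_yokeAut_zero h
  · rintro rfl h
    -- As `n = 1` is odd, the group is `D_2`, the Klein four-group.
    obtain ⟨e⟩ := (yokeRelations (Or.inr h) htop).nonempty_mulEquiv_dihedral (Or.inl odd_one)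
    obtain ⟨e'⟩ := dihedralGroup_two_mulEquiv
    exact ⟨e.trans e'⟩
  · exact fun h1 h2 h => (yokeRelations (Or.inl ⟨h1, h2⟩) htop).nonempty_mulEquiv_dihedral h
  · exact fun h1 h2 _ h => (yokeRelations (Or.inl ⟨h1, h2⟩) htop).nonempty_mulEquiv_prod h
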